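/- Let $\alpha\in(0,1]$, $\beta=\sqrt{1-\alpha^2}$ and $c>0$. Let $\{\boldsymbol f,\boldsymbol g,\boldsymbol h\}$, with $\boldsymbol f=\boldsymbol f_{c,\alpha}:\mathbb R\to\mathbb R^3$, be the unique solution on $\mathbb R$ (which exists) of the Serret--Frenet system $$\boldsymbol f'=k\boldsymbol g,\qquad \boldsymbol g'=-k\boldsymbol f+\tau\boldsymbol h,\qquad \boldsymbol h'=-\tau\boldsymbol g,\qquad k(x)=c\,e^{\alpha x^2/4},\quad \tau(x)=-\frac{\beta x}{2},$$ with $\boldsymbol f(0)=\boldsymbol e_1$, $\boldsymbol g(0)=\boldsymbol e_2$, $\boldsymbol h(0)=\boldsymbol e_3$. For $T\in\mathbb R$ set $\tilde{\boldsymbol m}_{c,\alpha}(x,t)=\boldsymbol f_{c,\alpha}\big(x/\sqrt{T-t}\big)$ for $x\in\mathbb R$, $t<T$, and let $\Phi_\alpha(x)=\int_0^x e^{\alpha s^2/4}\,ds$. Then, for every $T$, $\tilde{\boldsymbol m}_{c,\alpha}\in\mathcal C^\infty(\mathbb R\times(-\infty,T);\mathbb S^2)$, it solves the Landau--Lifshitz--Gilbert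 equation $$\partial_t\boldsymbol m=\beta\,\boldsymbol m\times\partial_{xx}\boldsymbol m-\alpha\,\boldsymbol m\times(\boldsymbol m\times\partial_{xx}\boldsymbol m)$$ on $\mathbb R\times(-\infty,T)$, and $$|\partial_x\tilde{\boldsymbol m}_{c,\alpha}(x,t)|=\frac{c}{\sqrt{T-t}}\,e^{\frac{\alpha x^2}{4(T-t)}}\qquad\text{for all }x\in\mathbb R,\ t<T.$$ Moreover: 1. The first component of $\boldsymbol f_{c,\alpha}$ is even and the other two are odd. 2. There exist constants $\rho_{j,c,\alpha}\in[0,1]$, $B_{j,c,\alpha}\in[-1,1]$, $\phi_{j,c,\alpha}\in[0,2\pi)$, $j\in\{1,2,3\}$, such that for all $x\ge1$ $$\begin{aligned}f_{j,c,\alpha}(x)={}&\rho_{j,c,\alpha}\cos\big(c\Phi_\alpha(x)-\phi_{j,c,\alpha}\big)-\frac{\beta B_{j,c,\alpha}}{2c}\,x\,e^{-\alpha x^2/4}\\&+\frac{\beta^2\rho_{j,c,\alpha}}{8c}\sin\big(c\Phi_\alpha(x)-\phi_{j,c,\alpha}\big)\int_x^\infty s^2e^{-\alpha s^2/4}\,ds+\frac{\beta}{\alpha^5c^2}\,R_{j,c,\alpha}(x),\end{aligned}$$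 where $|R_{j,c,\alpha}(x)|\le C x^2e^{-\alpha x^2/2}$ with a universal constant $C$, independent of $j$, $c$, $\alpha$ and $x$. 3. With the same constants, for every $T\in\mathbb R$ and $j\in\{1,2,3\}$, $$\lim_{t\to T^-}\Big(\tilde m_{j,c,\alpha}(x,t)-\rho_{j,c,\alpha}\cos\big(c\,\Phi_\alpha\big(\tfrac{x}{\sqrt{T-t}}\big)-\phi_{j,c,\alpha}\big)\Big)=0\quad\text{if }x>0,$$ $$\lim_{t\to T^-}\Big(\tilde m_{j,c,\alpha}(x,t)-\rho^-_{j,c,\alpha}\cos\big(c\,\Phi_\alpha\big(\tfrac{-x}{\sqrt{T-t}}\big)-\phi_{j,c,\alpha}\big)\Big)=0\quad\text{if }x<0,$$ where $\rho^-_{1,c,\alpha}=\rho_{1,c,\alpha}$, $\rho^-_{2,c,\alpha}=-\rho_{2,c,\alpha}$ and $\rho^-_{3,c,\alpha}=-\rho_{3,c,\alpha}$. 4. For every $T\in\mathbb R$, $\tilde{\boldsymbol m}_{c,\alpha}(\cdot,t)\to0$ as $t\to T^-$ as a tempered distribution. -/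

import Mathlib

open Set Filter Topology MeasureTheory
open scoped ContDiff SchwartzMap

namespace LLG

/-- Euclidean three-space, with the Euclidean norm. -/
abbrev E3 := EuclideanSpace ℝ (Fin 3)

/-- The cross product on Euclidean three-space. -/
noncomputable def cross (u v : E3) : E3 :=
  WithLp.toLp 2 (crossProduct (WithLp.ofLp u) (WithLp.ofLp v))

/-- The parameter `β = √(1 - α²)`. -/
noncomputable def beta (α : ℝ) : ℝ := Real.sqrt (1 - α ^ 2)

/-- The curvature `k(x) = c e^{α x² / 4}`. -/
noncomputable def curvature (α c x : ℝ) : ℝ := c * Real.exp (α * x ^ 2 / 4)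

/-- The torsion `τ(x) = -β x / 2`. -/
noncomputable def torsion (α x : ℝ) : ℝ := -(beta α * x) / 2

/-- `{f, g, h}` is a solution on the whole real line of the Serret-Frenet system with curvature
`c e^{α x² / 4}` and torsion `-β x / 2`, equal to the canonical basis at `0`.
The first vector `f` is the shrinker profile `f_{c,α}`. -/
structure IsShrinkerFrame (α c : ℝ) (f g h : ℝ → E3) : Prop where
  deriv_f : ∀ x, HasDerivAt f (curvature α c x • g x) x
  deriv_g : ∀ x, HasDerivAt g (-(curvature α c x) • f x + torsion α x • h x) x
  deriv_h : ∀ x, HasDerivAt h (-(torsion α x) • g x) x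
  f_zero : f 0 = EuclideanSpace.single 0 1
  g_zero : g 0 = EuclideanSpace.single 1 1
  h_zero : h 0 = EuclideanSpace.single 2 1

/-- The backward self-similar map `m(x,t) = f(x / √(T - t))` with profile `f`. -/
noncomputable def shrinker (f : ℝ → E3) (T x t : ℝ) : E3 := f (x / Real.sqrt (T - t))

/-- The map `m(x,t)` satisfies the one-dimensional Landau-Lifshitz-Gilbert equation
`∂ₜ m = β m × ∂ₓₓ m - α m × (m × ∂ₓₓ m)` at every `(x,t)` with `t < T`. -/
def SolvesLLG (α T : ℝ) (m : ℝ → ℝ → E3) : Prop :=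
  ∀ x t : ℝ, t < T →
    deriv (fun s => m x s) t =
      beta α • cross (m x t) (iteratedDeriv 2 (fun y => m y t) x)
        - α • cross (m x t) (cross (m x t) (iteratedDeriv 2 (fun y => m y t) x))

/-- The phase `Φ_α(x) = ∫_0^x e^{α s² / 4} ds`. -/
noncomputable def Phi (α x : ℝ) : ℝ := ∫ s in (0 : ℝ)..x, Real.exp (α * s ^ 2 / 4)

/-- The explicit part of the expansion at `+∞` of a component of the profile, with amplitude `ρ`,
coefficient `B` and phase shift `φ`. -/
noncomputable def profileExpansion (α c ρ B φ x : ℝ) : ℝ :=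
  ρ * Real.cos (c * Phi α x - φ)
    - beta α * B / (2 * c) * (x * Real.exp (-α * x ^ 2 / 4))
    + beta α ^ 2 * ρ / (8 * c) * Real.sin (c * Phi α x - φ)
      * ∫ s in Ioi x, s ^ 2 * Real.exp (-α * s ^ 2 / 4)

/-- The sign which a component of the profile picks up under `x ↦ -x`. -/
def paritySign (j : Fin 3) : ℝ := if j = 0 then 1 else -1

/-- `u` is the tempered distribution defined by the function `v`, that is
`u(ψ) = ∫ ψ v` for every Schwartz function `ψ`, the integral being absolutely convergent. -/
def IsTemperedDistributionOf (u : 𝓢'(ℝ, ℂ)) (v : ℝ → ℝ) : Prop :=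
  ∀ ψ : 𝓢(ℝ, ℂ),
    Integrable (fun x : ℝ => ψ x * (v x : ℂ)) ∧ u ψ = ∫ x : ℝ, ψ x * (v x : ℂ)

end LLG

namespace LLG

/-! ### Skew-symmetric linear systems -/

theorem norm_eq_of_skew {E : Type*} [NormedAddCommGroup E] [InnerProductSpace ℝ E]
    {A : ℝ → E → E} (hskew : ∀ t y, inner ℝ y (A t y) = 0) {y : ℝ → E} {R : ℝ}
    (hy : ∀ t ∈ Ioo (-R) R, HasDerivAt y (A t (y t)) t) :
    ∀ t ∈ Ioo (-R) R, ‖y t‖ = ‖y 0‖ := by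
  intro t ht
  have hR : 0 < R := by linarith [ht.1, ht.2]
  have h0 : (0 : ℝ) ∈ Ioo (-R) R := ⟨by linarith, hR⟩
  have hd : ∀ s ∈ Ioo (-R) R, HasDerivAt (fun s => ‖y s‖ ^ 2) 0 s := by
    intro s hs
    have := (hy s hs).norm_sq
    rwa [hskew, mul_zero] at this
  have hc := isOpen_Ioo.is_const_of_deriv_eq_zero isPreconnected_Ioo
    (fun s hs => (hd s hs).differentiableAt.differentiableWithinAt)
    (fun s hs => (hd s hs).deriv) ht h0
  exact (sq_eq_sq₀ (norm_nonneg _) (norm_nonneg _)).1 hc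

theorem exists_solution_Icc_of_skew {E : Type*} [NormedAddCommGroup E] [InnerProductSpace ℝ E]
    [FiniteDimensional ℝ E] {A : ℝ → E →L[ℝ] E} (hA : Continuous A)
    (hskew : ∀ t y, inner ℝ y (A t y) = 0) (y₀ : E) {R : ℝ} (hR : 0 < R) :
    ∃ y : ℝ → E, y 0 = y₀ ∧ ∀ t ∈ Ioo (-R) R, HasDerivAt y (A t (y t)) t := by
  let χ : ContDiffBump (0 : E) :=
    ⟨‖y₀‖ + 1, ‖y₀‖ + 2, by positivity, by linarith⟩
  let P : E → E := fun y => χ y • y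
  have hPc : HasCompactSupport P := χ.hasCompactSupport.smul_right
  have hP1 : ContDiff ℝ 1 P := χ.contDiff.smul contDiff_id
  obtain ⟨K, hK⟩ := hP1.lipschitzWith_of_hasCompactSupport hPc one_ne_zero
  obtain ⟨M, hM⟩ := hPc.exists_bound_of_continuous hP1.continuous
  obtain ⟨N, hN⟩ := isCompact_Icc.exists_bound_of_continuousOn (s := Icc (-R) R) hA.continuousOn
  have h0R : (0 : ℝ) ∈ Icc (-R) R := ⟨by linarith, hR.le⟩
  have hN0 : 0 ≤ N := (norm_nonneg _).trans (hN 0 h0R)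
  have hM0 : 0 ≤ M := (norm_nonneg _).trans (hM 0)
  have hpl : IsPicardLindelof (fun t y => A t (P y)) (⟨0, h0R⟩ : Icc (-R) R) y₀
      ((N * M * R).toNNReal) 0 ((N * M).toNNReal) (N.toNNReal * K) := by
    refine ⟨fun t ht => ?_, fun x _ => ?_, fun t ht x _ => ?_, ?_⟩
    · refine LipschitzWith.lipschitzOnWith (((A t).lipschitz.comp hK).weaken ?_)
      gcongr
      rw [← NNReal.coe_le_coe, Real.coe_toNNReal _ hN0]
      exact hN t ht
    · exact (hA.clm_apply continuous_const).continuousOn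
    · rw [Real.coe_toNNReal _ (by positivity)]
      exact (A t).le_of_opNorm_le_of_le (hN t ht) (hM x)
    · rw [Real.coe_toNNReal _ (by positivity), Real.coe_toNNReal _ (by positivity)]
      simp
  obtain ⟨y, hy0, hy⟩ := hpl.exists_eq_forall_mem_Icc_hasDerivWithinAt₀
  have hy' : ∀ t ∈ Ioo (-R) R, HasDerivAt y (A t (P (y t))) t := fun t ht =>
    (hy t (Ioo_subset_Icc_self ht)).hasDerivAt (Icc_mem_nhds ht.1 ht.2)
  have hnorm := norm_eq_of_skew (A := fun t y => A t (P y))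
    (fun t y => by simp [P, map_smul, inner_smul_right, hskew]) hy'
  refine ⟨y, hy0, fun t ht => ?_⟩
  have hP : P (y t) = y t := by
    have : χ (y t) = 1 := χ.one_of_mem_closedBall (by
      rw [mem_closedBall_zero_iff, hnorm t ht, hy0]
      exact le_of_lt (lt_add_one _))
    simp [P, this]
  simpa only [hP] using hy' t ht

theorem exists_solution_of_skew {E : Type*} [NormedAddCommGroup E] [InnerProductSpace ℝ E]
    [FiniteDimensional ℝ E] {A : ℝ → E →L[ℝ] E} (hA : Continuous A)
    (hskew : ∀ t y, inner ℝ y (A t y) = 0) (y₀ : E) :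
    ∃ y : ℝ → E, y 0 = y₀ ∧ ∀ t, HasDerivAt y (A t (y t)) t := by
  choose Y hY0 hY using fun n : ℕ =>
    exists_solution_Icc_of_skew hA hskew y₀ (R := (n : ℝ) + 1) (by positivity)
  have hYY : ∀ m n : ℕ, m ≤ n → ∀ t ∈ Ioo (-((m : ℝ) + 1)) ((m : ℝ) + 1), Y n t = Y m t := by
    intro m n hmn t ht
    have hmn' : (m : ℝ) ≤ n := by exact_mod_cast hmn
    have := norm_eq_of_skew (A := fun t y => A t y) hskew (y := Y n - Y m)
      (R := (m : ℝ) + 1) (fun s hs => by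
        have := (hY n s ⟨by linarith [hs.1], by linarith [hs.2]⟩).sub (hY m s hs)
        rwa [← map_sub] at this) t ht
    simp only [Pi.sub_apply, hY0, sub_self, norm_zero, norm_eq_zero] at this
    exact sub_eq_zero.1 this
  refine ⟨fun t => Y ⌈|t|⌉₊ t, hY0 _, fun t => ?_⟩
  have hmem : ∀ s (n : ℕ), |s| < (n : ℝ) + 1 → s ∈ Ioo (-((n : ℝ) + 1)) ((n : ℝ) + 1) :=
    fun s n h => abs_lt.1 h
  have key : ∀ s (n : ℕ), |s| < (n : ℝ) + 1 → Y ⌈|s|⌉₊ s = Y n s := by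
    intro s n hs
    rcases le_total ⌈|s|⌉₊ n with h | h
    · exact (hYY _ _ h s (hmem _ _ ((Nat.le_ceil _).trans_lt (lt_add_one _)))).symm
    · exact hYY _ _ h s (hmem _ _ hs)
  have ht : |t| < (⌈|t|⌉₊ : ℝ) + 1 := (Nat.le_ceil _).trans_lt (lt_add_one _)
  refine (hY _ t (hmem _ _ ht)).congr_of_eventuallyEq ?_
  filter_upwards [(continuous_abs.tendsto t).eventually (gt_mem_nhds ht)] with s hs
  exact key s _ hs

/-! ### The scalar Serret-Frenet system -/

/-- A solution of the scalar Serret-Frenet system with curvature `k` and torsion `τ`. -/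
structure FrenetSystem (k τ : ℝ → ℝ) (a b d : ℝ → ℝ) : Prop where
  deriv_a : ∀ x, HasDerivAt a (k x * b x) x
  deriv_b : ∀ x, HasDerivAt b (-(k x) * a x + τ x * d x) x
  deriv_d : ∀ x, HasDerivAt d (-(τ x) * b x) x

namespace FrenetSystem

variable {k τ : ℝ → ℝ} {a b d a' b' d' : ℝ → ℝ}

theorem inner_eq (h : FrenetSystem k τ a b d) (h' : FrenetSystem k τ a' b' d') (x : ℝ) :
    a x * a' x + b x * b' x + d x * d' x = a 0 * a' 0 + b 0 * b' 0 + d 0 * d' 0 := by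
  have hd : ∀ s, HasDerivAt (fun s => a s * a' s + b s * b' s + d s * d' s) 0 s := fun s =>
    ((((h.deriv_a s).mul (h'.deriv_a s)).add ((h.deriv_b s).mul (h'.deriv_b s))).add
      ((h.deriv_d s).mul (h'.deriv_d s))).congr_deriv (by ring)
  exact is_const_of_deriv_eq_zero (fun s => (hd s).differentiableAt) (fun s => (hd s).deriv) x 0

theorem sub (h : FrenetSystem k τ a b d) (h' : FrenetSystem k τ a' b' d') :
    FrenetSystem k τ (fun x => a x - a' x) (fun x => b x - b' x) (fun x => d x - d' x) where
  deriv_a x :=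
    ((h.deriv_a x).sub (h'.deriv_a x)).congr_deriv (by ring)
  deriv_b x :=
    ((h.deriv_b x).sub (h'.deriv_b x)).congr_deriv (by ring)
  deriv_d x :=
    ((h.deriv_d x).sub (h'.deriv_d x)).congr_deriv (by ring)

theorem neg (h : FrenetSystem k τ a b d) :
    FrenetSystem k τ (fun x => -a x) (fun x => -b x) (fun x => -d x) where
  deriv_a x :=
    (h.deriv_a x).neg.congr_deriv (by ring)
  deriv_b x :=
    ((h.deriv_b x).neg).congr_deriv (by ring)
  deriv_d x :=
    ((h.deriv_d x).neg).congr_deriv (by ring)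

theorem eq_zero (h : FrenetSystem k τ a b d) (ha : a 0 = 0) (hb : b 0 = 0) (hd : d 0 = 0)
    (x : ℝ) : a x = 0 ∧ b x = 0 ∧ d x = 0 := by
  have := h.inner_eq h x
  rw [ha, hb, hd] at this
  refine ⟨?_, ?_, ?_⟩ <;> nlinarith [sq_nonneg (a x), sq_nonneg (b x), sq_nonneg (d x)]

theorem unique (h : FrenetSystem k τ a b d) (h' : FrenetSystem k τ a' b' d')
    (ha : a 0 = a' 0) (hb : b 0 = b' 0) (hd : d 0 = d' 0) (x : ℝ) :
    a x = a' x ∧ b x = b' x ∧ d x = d' x := by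
  have := (h.sub h').eq_zero (by simp [ha]) (by simp [hb]) (by simp [hd]) x
  simpa only [sub_eq_zero] using this

/-- Reflection of a solution when the curvature is even and the torsion is odd. -/
theorem reflect (h : FrenetSystem k τ a b d) (hk : ∀ x, k (-x) = k x) (hτ : ∀ x, τ (-x) = -τ x) :
    FrenetSystem k τ (fun x => a (-x)) (fun x => -b (-x)) (fun x => -d (-x)) where
  deriv_a x :=
    ((h.deriv_a (-x)).scomp x (hasDerivAt_neg x)).congr_deriv (by simp [hk])
  deriv_b x :=
    ((h.deriv_b (-x)).scomp x (hasDerivAt_neg x)).neg.congr_deriv (by simp [hk, hτ])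
  deriv_d x :=
    ((h.deriv_d (-x)).scomp x (hasDerivAt_neg x)).neg.congr_deriv (by simp [hτ])

end FrenetSystem

/-- The coefficient matrix of the Serret-Frenet system, as an operator on `E3`. -/
noncomputable def frenetOp : E3 →L[ℝ] E3 := LinearMap.toContinuousLinearMap
  (Matrix.toEuclideanLin (!![0, 1, 0; -1, 0, 0; 0, 0, 0] : Matrix (Fin 3) (Fin 3) ℝ))

/-- The torsion part of the Serret-Frenet system, as an operator on `E3`. -/
noncomputable def frenetTorsionOp : E3 →L[ℝ] E3 := LinearMap.toContinuousLinearMap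
  (Matrix.toEuclideanLin (!![0, 0, 0; 0, 0, 1; 0, -1, 0] : Matrix (Fin 3) (Fin 3) ℝ))

theorem FrenetSystem.exists {k τ : ℝ → ℝ} (hk : Continuous k) (hτ : Continuous τ)
    (a₀ b₀ d₀ : ℝ) :
    ∃ a b d : ℝ → ℝ, FrenetSystem k τ a b d ∧ a 0 = a₀ ∧ b 0 = b₀ ∧ d 0 = d₀ := by
  have hop : ∀ t (y : E3), (k t • frenetOp + τ t • frenetTorsionOp) y
      = !₂[k t * y 1, -(k t) * y 0 + τ t * y 2, -(τ t) * y 1] := by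
    intro t y
    ext i
    fin_cases i <;>
      simp [frenetOp, frenetTorsionOp, Matrix.toLpLin_apply, dotProduct,
        Fin.sum_univ_three]
  obtain ⟨y, hy0, hy⟩ := exists_solution_of_skew
    (A := fun t => k t • frenetOp + τ t • frenetTorsionOp) (by fun_prop)
    (fun t y => by
      rw [hop]
      simp [PiLp.inner_apply, Fin.sum_univ_three]
      ring) (!₂[a₀, b₀, d₀] : E3)
  have hc : ∀ (i : Fin 3) t, HasDerivAt (fun t => y t i)
      ((!₂[k t * y t 1, -(k t) * y t 0 + τ t * y t 2, -(τ t) * y t 1] : E3) i) t := by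
    intro i t
    rw [← hop]
    exact (EuclideanSpace.proj (𝕜 := ℝ) i).hasFDerivAt.comp_hasDerivAt t (hy t)
  exact ⟨fun t => y t 0, fun t => y t 1, fun t => y t 2,
    ⟨fun t => hc 0 t, fun t => hc 1 t, fun t => hc 2 t⟩, by simp [hy0], by simp [hy0],
    by simp [hy0]⟩

theorem hasDerivAt_euclidean_iff {n : ℕ} {f : ℝ → EuclideanSpace ℝ (Fin n)}
    {f' : EuclideanSpace ℝ (Fin n)} {x : ℝ} :
    HasDerivAt f f' x ↔ ∀ i, HasDerivAt (fun y => f y i) (f' i) x := by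
  simp only [← hasDerivWithinAt_univ, hasDerivWithinAt_iff_hasFDerivWithinAt]
  rw [hasFDerivWithinAt_euclidean]
  refine forall_congr' fun i => ?_
  congr!

theorem cross_apply_zero (u v : E3) : cross u v 0 = u 1 * v 2 - u 2 * v 1 := by
  simp [cross, cross_apply]

theorem cross_apply_one (u v : E3) : cross u v 1 = u 2 * v 0 - u 0 * v 2 := by
  simp [cross, cross_apply]

theorem cross_apply_two (u v : E3) : cross u v 2 = u 0 * v 1 - u 1 * v 0 := by
  simp [cross, cross_apply]

theorem hasDerivAt_curvature (α c x : ℝ) :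
    HasDerivAt (curvature α c) (α * x / 2 * curvature α c x) x := by
  unfold curvature
  refine (((((hasDerivAt_id x).pow 2).const_mul α).div_const 4).exp.const_mul c).congr_deriv ?_
  simp
  ring

theorem contDiff_curvature (α c : ℝ) {n : WithTop ℕ∞} : ContDiff ℝ n (curvature α c) := by
  unfold curvature
  fun_prop

theorem contDiff_torsion (α : ℝ) {n : WithTop ℕ∞} : ContDiff ℝ n (torsion α) := by
  unfold torsion
  fun_prop

theorem curvature_pos {c : ℝ} (hc : 0 < c) (α x : ℝ) : 0 < curvature α c x :=
  mul_pos hc (Real.exp_pos _)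

theorem curvature_neg (α c x : ℝ) : curvature α c (-x) = curvature α c x := by
  simp [curvature]

theorem torsion_neg (α x : ℝ) : torsion α (-x) = -torsion α x := by
  simp [torsion, neg_div]

theorem beta_nonneg (α : ℝ) : 0 ≤ beta α := Real.sqrt_nonneg _

theorem beta_sq {α : ℝ} (h0 : 0 < α) (h1 : α ≤ 1) : beta α ^ 2 = 1 - α ^ 2 :=
  Real.sq_sqrt (by nlinarith)

theorem beta_le_one (α : ℝ) : beta α ≤ 1 :=
  Real.sqrt_le_one.2 (by nlinarith [sq_nonneg α])

namespace IsShrinkerFrame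

variable {α c : ℝ} {f g h : ℝ → E3}

theorem row (H : IsShrinkerFrame α c f g h) (j : Fin 3) :
    FrenetSystem (curvature α c) (torsion α) (fun x => f x j) (fun x => g x j)
      (fun x => h x j) where
  deriv_a x := by simpa using hasDerivAt_euclidean_iff.1 (H.deriv_f x) j
  deriv_b x := by simpa using hasDerivAt_euclidean_iff.1 (H.deriv_g x) j
  deriv_d x := by simpa using hasDerivAt_euclidean_iff.1 (H.deriv_h x) j

theorem row_inner (H : IsShrinkerFrame α c f g h) (i j : Fin 3) (x : ℝ) :
    f x i * f x j + g x i * g x j + h x i * h x j = if i = j then 1 else 0 := by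
  refine ((H.row i).inner_eq (H.row j) x).trans ?_
  rw [H.f_zero, H.g_zero, H.h_zero]
  fin_cases i <;> fin_cases j <;> simp

theorem exists_frame (α c : ℝ) : ∃ f g h, IsShrinkerFrame α c f g h := by
  choose a b d H h0 using fun j : Fin 3 =>
    FrenetSystem.exists (contDiff_curvature α c (n := 0)).continuous
      (contDiff_torsion α (n := 0)).continuous
      (if j = 0 then 1 else 0) (if j = 1 then 1 else 0) (if j = 2 then 1 else 0)
  refine ⟨fun x => WithLp.toLp 2 fun j => a j x, fun x => WithLp.toLp 2 fun j => b j x,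
    fun x => WithLp.toLp 2 fun j => d j x, ⟨fun x => ?_, fun x => ?_, fun x => ?_, ?_, ?_, ?_⟩⟩
  · exact hasDerivAt_euclidean_iff.2 fun j => by simpa using (H j).deriv_a x
  · exact hasDerivAt_euclidean_iff.2 fun j => by simpa using (H j).deriv_b x
  · exact hasDerivAt_euclidean_iff.2 fun j => by simpa using (H j).deriv_d x
  · ext j; simp [(h0 j).1]
  · ext j; simp [(h0 j).2.1]
  · ext j; simp [(h0 j).2.2]

theorem unique {f' g' h' : ℝ → E3} (H : IsShrinkerFrame α c f g h)
    (H' : IsShrinkerFrame α c f' g' h') : f = f' ∧ g = g' ∧ h = h' := by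
  have key := fun (x : ℝ) (j : Fin 3) => (H.row j).unique (H'.row j)
    (by simp [H.f_zero, H'.f_zero]) (by simp [H.g_zero, H'.g_zero])
    (by simp [H.h_zero, H'.h_zero]) x
  exact ⟨funext fun x => PiLp.ext fun j => (key x j).1,
    funext fun x => PiLp.ext fun j => (key x j).2.1,
    funext fun x => PiLp.ext fun j => (key x j).2.2⟩

theorem existsUnique (α c : ℝ) : ∃! F : (ℝ → E3) × (ℝ → E3) × (ℝ → E3),
    IsShrinkerFrame α c F.1 F.2.1 F.2.2 := by
  obtain ⟨f, g, h, H⟩ := exists_frame α c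
  refine ⟨(f, g, h), H, ?_⟩
  rintro ⟨f', g', h'⟩ H'
  obtain ⟨rfl, rfl, rfl⟩ := H.unique H'
  rfl

/-- The defects of the relations `g × h = f`, `h × f = g`, `f × g = h` solve the same system,
in each component. -/
theorem crossDefect (H : IsShrinkerFrame α c f g h) (i j : Fin 3) :
    FrenetSystem (curvature α c) (torsion α)
      (fun x => g x i * h x j - g x j * h x i) (fun x => h x i * f x j - h x j * f x i)
      (fun x => f x i * g x j - f x j * g x i) where
  deriv_a x := ((((H.row i).deriv_b x).mul ((H.row j).deriv_d x)).sub
    (((H.row j).deriv_b x).mul ((H.row i).deriv_d x))).congr_deriv (by ring)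
  deriv_b x := ((((H.row i).deriv_d x).mul ((H.row j).deriv_a x)).sub
    (((H.row j).deriv_d x).mul ((H.row i).deriv_a x))).congr_deriv (by ring)
  deriv_d x := ((((H.row i).deriv_a x).mul ((H.row j).deriv_b x)).sub
    (((H.row j).deriv_a x).mul ((H.row i).deriv_b x))).congr_deriv (by ring)

theorem cross_fg_hf (H : IsShrinkerFrame α c f g h) (x : ℝ) :
    cross (f x) (g x) = h x ∧ cross (h x) (f x) = g x := by
  have key := fun i j k (hf : _) (hg : _) (hh : _) =>
    (H.crossDefect i j).unique (H.row k) hf hg hh x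
  have h0 := key 1 2 0 (by simp [H.f_zero, H.g_zero, H.h_zero])
    (by simp [H.f_zero, H.g_zero, H.h_zero]) (by simp [H.f_zero, H.g_zero, H.h_zero])
  have h1 := key 2 0 1 (by simp [H.f_zero, H.g_zero, H.h_zero])
    (by simp [H.f_zero, H.g_zero, H.h_zero]) (by simp [H.f_zero, H.g_zero, H.h_zero])
  have h2 := key 0 1 2 (by simp [H.f_zero, H.g_zero, H.h_zero])
    (by simp [H.f_zero, H.g_zero, H.h_zero]) (by simp [H.f_zero, H.g_zero, H.h_zero])
  constructor <;> refine PiLp.ext fun j => ?_ <;> fin_cases j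
  · exact (cross_apply_zero _ _).trans h0.2.2
  · exact (cross_apply_one _ _).trans h1.2.2
  · exact (cross_apply_two _ _).trans h2.2.2
  · exact (cross_apply_zero _ _).trans h0.2.1
  · exact (cross_apply_one _ _).trans h1.2.1
  · exact (cross_apply_two _ _).trans h2.2.1

theorem norm_f_g (H : IsShrinkerFrame α c f g h) (x : ℝ) : ‖f x‖ = 1 ∧ ‖g x‖ = 1 := by
  let M : Matrix (Fin 3) (Fin 3) ℝ := Matrix.of fun i => ![f x i, g x i, h x i]
  have hM : M * M.transpose = 1 := by
    ext i j
    rw [Matrix.mul_apply, Fin.sum_univ_three, Matrix.one_apply]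
    simpa [M] using H.row_inner i j x
  have hM' := mul_eq_one_comm.1 hM
  have h0 := congrFun (congrFun hM' 0) 0
  have h1 := congrFun (congrFun hM' 1) 1
  rw [Matrix.mul_apply, Fin.sum_univ_three] at h0 h1
  simp [M] at h0 h1
  simp only [EuclideanSpace.norm_eq, Real.sqrt_eq_one, Fin.sum_univ_three, Real.norm_eq_abs,
    sq_abs]
  exact ⟨by linarith, by linarith⟩

theorem even_odd (H : IsShrinkerFrame α c f g h) (j : Fin 3) (x : ℝ) :
    f (-x) j = paritySign j * f x j := by
  have hr := (H.row j).reflect (curvature_neg α c) (torsion_neg α)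
  by_cases hj : j = 0
  · subst hj
    simpa [paritySign] using (hr.unique (H.row 0) (by simp) (by simp [H.g_zero])
      (by simp [H.h_zero]) x).1
  · simpa [paritySign, hj] using (hr.unique (H.row j).neg
      (by simp [H.f_zero, hj]) (by simp) (by simp) x).1

theorem contDiff_nat (H : IsShrinkerFrame α c f g h) (n : ℕ) :
    ContDiff ℝ n f ∧ ContDiff ℝ n g ∧ ContDiff ℝ n h := by
  have hf := fun x => (H.deriv_f x).differentiableAt
  have hg := fun x => (H.deriv_g x).differentiableAt
  have hh := fun x => (H.deriv_h x).differentiableAt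
  induction n with
  | zero =>
    simp only [Nat.cast_zero, contDiff_zero]
    exact ⟨Differentiable.continuous hf, Differentiable.continuous hg,
      Differentiable.continuous hh⟩
  | succ n ih =>
    obtain ⟨if', ig, ih⟩ := ih
    have hk := contDiff_curvature α c (n := n)
    have ht := contDiff_torsion α (n := n)
    push_cast
    simp only [contDiff_succ_iff_deriv]
    refine ⟨⟨hf, by simp, ?_⟩, ⟨hg, by simp, ?_⟩, ⟨hh, by simp, ?_⟩⟩
    · rw [funext fun x => (H.deriv_f x).deriv]
      exact hk.smul ig
    · rw [funext fun x => (H.deriv_g x).deriv]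
      exact (hk.neg.smul if').add (ht.smul ih)
    · rw [funext fun x => (H.deriv_h x).deriv]
      exact ht.neg.smul ig

theorem contDiff (H : IsShrinkerFrame α c f g h) : ContDiff ℝ ∞ f :=
  contDiff_infty.2 fun n => (H.contDiff_nat n).1

theorem contDiffOn_shrinker (H : IsShrinkerFrame α c f g h) (T : ℝ) :
    ContDiffOn ℝ ∞ (fun p : ℝ × ℝ => shrinker f T p.1 p.2) ((univ : Set ℝ) ×ˢ Iio T) := by
  unfold shrinker
  refine H.contDiff.comp_contDiffOn (contDiffOn_fst.div
    ((contDiffOn_const.sub contDiffOn_snd).sqrt fun p hp => ?_) fun p hp => ?_)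
  · exact (sub_pos.2 hp.2).ne'
  · exact (Real.sqrt_pos.2 (sub_pos.2 hp.2)).ne'

theorem hasDerivAt_shrinker_space (H : IsShrinkerFrame α c f g h) (T t x : ℝ) :
    HasDerivAt (fun y => shrinker f T y t)
      ((Real.sqrt (T - t))⁻¹ • curvature α c (x / Real.sqrt (T - t)) •
        g (x / Real.sqrt (T - t))) x :=
  ((H.deriv_f _).scomp x ((hasDerivAt_id x).div_const _)).congr_deriv (by simp)

theorem iteratedDeriv_two_shrinker (H : IsShrinkerFrame α c f g h) {T t : ℝ} (ht : t < T)
    (x y : ℝ) (hy : y = x / Real.sqrt (T - t)) :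
    iteratedDeriv 2 (fun y => shrinker f T y t) x =
      (T - t)⁻¹ • ((α * y / 2 * curvature α c y) • g y + curvature α c y •
        (-(curvature α c y) • f y + torsion α y • h y)) := by
  rw [iteratedDeriv_succ, iteratedDeriv_one,
    funext fun x => (H.hasDerivAt_shrinker_space T t x).deriv]
  have hd := ((hasDerivAt_curvature α c (x / Real.sqrt (T - t))).smul
    (H.deriv_g (x / Real.sqrt (T - t)))).scomp x ((hasDerivAt_id x).div_const (Real.sqrt (T - t)))
  refine ((hd.const_smul (Real.sqrt (T - t))⁻¹).congr_deriv ?_).deriv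
  rw [← hy, smul_smul, one_div, ← mul_inv, Real.mul_self_sqrt (sub_pos.2 ht).le, add_comm]

theorem hasDerivAt_shrinker_time (H : IsShrinkerFrame α c f g h) {T t : ℝ} (ht : t < T)
    (x y : ℝ) (hy : y = x / Real.sqrt (T - t)) :
    HasDerivAt (fun s => shrinker f T x s)
      ((y / (2 * (T - t)) * curvature α c y) • g y) t := by
  have hp : 0 < T - t := sub_pos.2 ht
  have hs : 0 < Real.sqrt (T - t) := Real.sqrt_pos.2 hp
  have hd : HasDerivAt (fun s => x / Real.sqrt (T - s)) (y / (2 * (T - t))) t := by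
    refine ((hasDerivAt_const t x).div (((hasDerivAt_id t).const_sub T).sqrt hp.ne')
      hs.ne').congr_deriv ?_
    rw [hy]
    simp only [id]
    rw [Real.sq_sqrt hp.le]
    field_simp
    ring
  have := (H.deriv_f (x / Real.sqrt (T - t))).scomp t hd
  rw [← hy, smul_smul] at this
  exact this

theorem solvesLLG (H : IsShrinkerFrame α c f g h) (h0 : 0 < α) (h1 : α ≤ 1) (T : ℝ) :
    SolvesLLG α T (shrinker f T) := by
  intro x t ht
  have hp : 0 < T - t := sub_pos.2 ht
  rw [(H.hasDerivAt_shrinker_time ht x _ rfl).deriv, H.iteratedDeriv_two_shrinker ht x _ rfl]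
  unfold shrinker
  generalize x / Real.sqrt (T - t) = y
  obtain ⟨e1, e2⟩ := H.cross_fg_hf y
  have hadd : ∀ u v w : E3, cross u (v + w) = cross u v + cross u w := fun u v w => by
    simp [cross]
  have hsmul : ∀ (a : ℝ) (u v : E3), cross u (a • v) = a • cross u v := fun a u v => by
    simp [cross]
  have hself : cross (f y) (f y) = 0 := by simp [cross]
  have e3 : cross (f y) (h y) = -g y := by
    rw [← e2, cross, cross, ← WithLp.toLp_neg, cross_anticomm]
  have hneg : cross (f y) (-g y) = -h y := by
    rw [← neg_one_smul ℝ (g y), hsmul, e1, neg_one_smul]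
  have hzero : cross (f y) 0 = 0 := by simp [cross]
  simp only [hsmul, hadd, hself, hzero, e1, e3, hneg]
  have hb := beta_sq h0 h1
  unfold torsion
  refine PiLp.ext fun j => ?_
  simp only [PiLp.add_apply, PiLp.sub_apply, PiLp.smul_apply, PiLp.neg_apply, smul_eq_mul,
    PiLp.zero_apply]
  field_simp
  linear_combination (-y * curvature α c y * g y j) * hb

theorem norm_deriv_shrinker (H : IsShrinkerFrame α c f g h) (hc : 0 < c) {T t : ℝ} (ht : t < T)
    (x : ℝ) : ‖deriv (fun y => shrinker f T y t) x‖ =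
      c / Real.sqrt (T - t) * Real.exp (α * x ^ 2 / (4 * (T - t))) := by
  have hp : 0 < T - t := sub_pos.2 ht
  rw [(H.hasDerivAt_shrinker_space T t x).deriv, norm_smul, norm_smul, (H.norm_f_g _).2, mul_one,
    norm_inv, Real.norm_of_nonneg (Real.sqrt_nonneg _), Real.norm_of_nonneg (curvature_pos hc _ _).le,
    curvature, div_pow, Real.sq_sqrt hp.le]
  have : α * (x ^ 2 / (T - t)) / 4 = α * x ^ 2 / (4 * (T - t)) := by
    field_simp
  rw [this]
  ring

end IsShrinkerFrame

/-! ### Limits of functions whose derivative is dominated -/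

theorem exists_tendsto_of_norm_deriv_le {E : Type*} [NormedAddCommGroup E] [NormedSpace ℝ E]
    [CompleteSpace E] {W W' : ℝ → E} {M M' : ℝ → ℝ} {x₀ : ℝ}
    (hW : ∀ s, HasDerivAt W (W' s) s) (hM : ∀ s, HasDerivAt M (M' s) s)
    (bound : ∀ s, x₀ ≤ s → ‖W' s‖ ≤ -M' s) (hM0 : Tendsto M atTop (𝓝 0)) :
    ∃ L, Tendsto W atTop (𝓝 L) ∧ ∀ x, x₀ ≤ x → ‖L - W x‖ ≤ M x := by
  have hle : ∀ x, x₀ ≤ x → ∀ y, x ≤ y → ‖W y - W x‖ ≤ M x - M y := by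
    intro x hx y hxy
    refine image_norm_le_of_norm_deriv_right_le_deriv_boundary (a := x) (b := y)
      (f := fun s => W s - W x) (f' := W') (B := fun s => M x - M s) (B' := fun s => -M' s)
      (fun s _ => ((hW s).sub_const _).continuousAt.continuousWithinAt)
      (fun s _ => ((hW s).sub_const _).hasDerivWithinAt) (by simp)
      (fun s => (hM s).const_sub _) (fun s hs => bound s (hx.trans hs.1)) ⟨hxy, le_rfl⟩
  have hpos : ∀ x, x₀ ≤ x → 0 ≤ M x := by
    intro x hx
    have h : ∀ᶠ y in atTop, M y ≤ M x := by
      filter_upwards [eventually_ge_atTop x] with y hy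
      linarith [hle x hx y hy, norm_nonneg (W y - W x)]
    exact le_of_tendsto hM0 h
  have hC : Cauchy (map W atTop) := by
    rw [Metric.cauchy_iff]
    refine ⟨inferInstance, fun ε hε => ?_⟩
    obtain ⟨N, hN⟩ := ((hM0.eventually (gt_mem_nhds (half_pos hε))).and
      (eventually_ge_atTop x₀)).exists
    refine ⟨W '' Ici N, image_mem_map (Ici_mem_atTop N), ?_⟩
    have hd : ∀ y, N ≤ y → ‖W y - W N‖ < ε / 2 := fun y hy => by
      linarith [hle N hN.2 y hy, hpos y (hN.2.trans hy), hN.1]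
    rintro _ ⟨y, hy, rfl⟩ _ ⟨y', hy', rfl⟩
    rw [dist_eq_norm]
    calc ‖W y - W y'‖ = ‖(W y - W N) - (W y' - W N)‖ := by rw [sub_sub_sub_cancel_right]
      _ ≤ ‖W y - W N‖ + ‖W y' - W N‖ := norm_sub_le _ _
      _ < ε := by linarith [hd y hy, hd y' hy']
  obtain ⟨L, hL⟩ := CompleteSpace.complete hC
  have hL' : Tendsto W atTop (𝓝 L) := hL
  refine ⟨L, hL', fun x hx => ?_⟩
  refine le_of_tendsto (hL'.sub_const (W x)).norm ?_
  filter_upwards [eventually_ge_atTop x] with y hy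
  linarith [hle x hx y hy, hpos y (hx.trans hy)]

/-! ### Gaussian weights -/

theorem hasDerivAt_gaussian (κ s : ℝ) :
    HasDerivAt (fun s => Real.exp (-κ * s ^ 2)) (-(2 * κ * s) * Real.exp (-κ * s ^ 2)) s := by
  refine (((hasDerivAt_id s).pow 2).const_mul (-κ)).exp.congr_deriv ?_
  simp
  ring

theorem tendsto_pow_mul_gaussian {κ : ℝ} (hκ : 0 < κ) (n : ℕ) :
    Tendsto (fun s : ℝ => s ^ n * Real.exp (-κ * s ^ 2)) atTop (𝓝 0) := by
  refine ((tendsto_rpow_abs_mul_exp_neg_mul_sq_cocompact hκ n).mono_left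
    atTop_le_cocompact).congr' ?_
  filter_upwards [eventually_ge_atTop 0] with s hs
  rw [abs_of_nonneg hs, Real.rpow_natCast]

theorem integrable_sq_mul_gaussian {κ : ℝ} (hκ : 0 < κ) :
    Integrable (fun s : ℝ => s ^ 2 * Real.exp (-κ * s ^ 2)) := by
  simpa using integrable_rpow_mul_exp_neg_mul_sq hκ (s := 2) (by norm_num)

theorem integral_Ioi_eq_sub {F : ℝ → ℝ} (hi : Integrable F) :
    (fun x => ∫ s in Ioi x, F s) = fun x => (∫ s in Ioi 0, F s) - ∫ s in (0 : ℝ)..x, F s := by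
  ext x
  rw [← intervalIntegral.integral_Ioi_sub_Ioi' hi.integrableOn hi.integrableOn]
  ring

theorem hasDerivAt_integral_Ioi {F : ℝ → ℝ} (hF : Continuous F) (hi : Integrable F) (x : ℝ) :
    HasDerivAt (fun x => ∫ s in Ioi x, F s) (-F x) x := by
  rw [integral_Ioi_eq_sub hi]
  exact (intervalIntegral.integral_hasDerivAt_right (hF.intervalIntegrable _ _)
    (hF.stronglyMeasurableAtFilter _ _) hF.continuousAt).const_sub _

theorem tendsto_integral_Ioi_zero {F : ℝ → ℝ} (hi : Integrable F) :
    Tendsto (fun x => ∫ s in Ioi x, F s) atTop (𝓝 0) := by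
  rw [integral_Ioi_eq_sub hi]
  simpa using (intervalIntegral_tendsto_integral_Ioi 0 hi.integrableOn tendsto_id).const_sub
    (∫ s in Ioi 0, F s)

theorem hasDerivAt_Phi (α x : ℝ) : HasDerivAt (Phi α) (Real.exp (α * x ^ 2 / 4)) x := by
  have hF : Continuous fun s : ℝ => Real.exp (α * s ^ 2 / 4) := by fun_prop
  exact intervalIntegral.integral_hasDerivAt_right (hF.intervalIntegrable _ _)
    (hF.stronglyMeasurableAtFilter _ _) hF.continuousAt

/-! ### Normal form of the system in the oscillating frame -/

/-- The components `a`, `b` of a solution in the frame rotating with phase `θ`. -/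
noncomputable def rotating (θ a b : ℝ → ℝ) (s : ℝ) : ℂ :=
  Complex.exp (θ s * Complex.I) * (a s + b s * Complex.I)

theorem norm_exp_mul_le {θ a b : ℝ} (h : a ^ 2 + b ^ 2 ≤ 1) :
    ‖Complex.exp (θ * Complex.I) * (a + b * Complex.I)‖ ≤ 1 := by
  rw [norm_mul, Complex.norm_exp_ofReal_mul_I, one_mul, Complex.norm_add_mul_I]
  exact Real.sqrt_le_one.2 h

namespace FrenetSystem

variable {k τ a b d r r' p p' θ : ℝ → ℝ}

theorem hasDerivAt_phase (hθ : ∀ s, HasDerivAt θ (k s) s) (s : ℝ) :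
    HasDerivAt (fun s => Complex.exp (θ s * Complex.I))
      (Complex.exp (θ s * Complex.I) * (k s * Complex.I)) s :=
  ((hθ s).ofReal_comp.mul_const Complex.I).cexp

theorem hasDerivAt_rotating_sub (H : FrenetSystem k τ a b d) (hθ : ∀ s, HasDerivAt θ (k s) s)
    (hr : ∀ s, HasDerivAt r (r' s) s) (hrk : ∀ s, r s * k s = τ s) (s : ℝ) :
    HasDerivAt (fun s => rotating θ a b s - Complex.exp (θ s * Complex.I) * (r s * d s))
      (Complex.exp (θ s * Complex.I) * (-(r' s) * d s + r s * τ s * b s)) s := by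
  have he := hasDerivAt_phase hθ s
  refine ((he.mul ((H.deriv_a s).ofReal_comp.add
    ((H.deriv_b s).ofReal_comp.mul_const Complex.I))).sub
    (he.mul ((hr s).ofReal_comp.mul (H.deriv_d s).ofReal_comp))).congr_deriv ?_
  have hk : (r s : ℂ) * k s = τ s := by exact_mod_cast hrk s
  push_cast
  simp only [Pi.add_apply, Pi.mul_apply]
  linear_combination (exp := 1) (-Complex.exp (θ s * Complex.I) * d s * Complex.I) * hk +
    (Complex.exp (θ s * Complex.I) * k s * b s) * Complex.I_sq

theorem hasDerivAt_add_mul (H : FrenetSystem k τ a b d)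
    (hr : ∀ s, HasDerivAt r (r' s) s) (hrk : ∀ s, r s * k s = τ s) (s : ℝ) :
    HasDerivAt (fun s => d s + r s * a s) (r' s * a s) s :=
  ((H.deriv_d s).add ((hr s).mul (H.deriv_a s))).congr_deriv (by
    linear_combination (b s) * hrk s)

theorem hasDerivAt_rotating_sub_second (H : FrenetSystem k τ a b d)
    (hθ : ∀ s, HasDerivAt θ (k s) s)
    (hr : ∀ s, HasDerivAt r (r' s) s) (hrk : ∀ s, r s * k s = τ s)
    (hp : ∀ s, HasDerivAt p (p' s) s) (hpk : ∀ s, p s * k s = r' s)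
    {J : ℝ → ℝ} (hJ : ∀ s, HasDerivAt J (-(r s * τ s)) s) (w₀ : ℂ) (s : ℝ) :
    HasDerivAt (fun s => rotating θ a b s
        - Complex.exp (θ s * Complex.I) * (r s * d s)
        - Complex.exp (θ s * Complex.I) * (p s * d s) * Complex.I
        - (J s) * (w₀ * Complex.I / 2)
        - Complex.exp (θ s * Complex.I) * (a s - b s * Complex.I) * (r s) ^ 2 / 4)
      (Complex.exp (θ s * Complex.I) * ((-(p' s) * d s + p s * τ s * b s) * Complex.I)
        - r s * τ s * (rotating θ a b s - w₀) * Complex.I / 2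
        - Complex.exp (θ s * Complex.I) * (a s - b s * Complex.I) * (r s * r' s) / 2
        + Complex.exp (θ s * Complex.I) * ((r s) ^ 2 * τ s * d s) * Complex.I / 4) s := by
  have he := hasDerivAt_phase hθ s
  refine ((((H.hasDerivAt_rotating_sub hθ hr hrk s).sub
    ((he.mul ((hp s).ofReal_comp.mul (H.deriv_d s).ofReal_comp)).mul_const Complex.I)).sub
    ((hJ s).ofReal_comp.mul_const (w₀ * Complex.I / 2))).sub
    (((he.mul ((H.deriv_a s).ofReal_comp.sub
      ((H.deriv_b s).ofReal_comp.mul_const Complex.I))).mul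
        ((hr s).ofReal_comp.pow 2)).div_const 4)).congr_deriv ?_
  have hk : (r s : ℂ) * k s = τ s := by exact_mod_cast hrk s
  have hpk' : (p s : ℂ) * k s = r' s := by exact_mod_cast hpk s
  unfold rotating
  push_cast
  simp only [Pi.sub_apply, Pi.mul_apply, Pi.pow_apply]
  simp only [← hk, ← hpk']
  linear_combination (exp := 1) (Complex.exp (θ s * Complex.I) * (-(p s * k s * d s)
    + 3 / 4 * (r s) ^ 2 * k s * b s)) * Complex.I_sq

end FrenetSystem

/-! ### The ratio of torsion to curvature -/

/-- The Gaussian weight `e^{-α s² / 4}`. -/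
noncomputable def weight (α s : ℝ) : ℝ := Real.exp (-(α / 4) * s ^ 2)

/-- The ratio `τ / k`. -/
noncomputable def ratio (α c s : ℝ) : ℝ := -(beta α / c / 2) * (s * weight α s)

/-- The derivative of `τ / k`. -/
noncomputable def ratioDeriv (α c s : ℝ) : ℝ :=
  -(beta α / c / 2) * ((1 - α * s ^ 2 / 2) * weight α s)

/-- The function `(τ / k)' / k`. -/
noncomputable def ratioSnd (α c s : ℝ) : ℝ :=
  -(beta α / c / c / 2) * ((1 - α * s ^ 2 / 2) * weight α s ^ 2)

/-- The derivative of `(τ / k)' / k`. -/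
noncomputable def ratioSndDeriv (α c s : ℝ) : ℝ :=
  beta α / c / c / 2 * (α * s * (2 - α * s ^ 2 / 2) * weight α s ^ 2)

theorem weight_pos (α s : ℝ) : 0 < weight α s := Real.exp_pos _

theorem weight_mul_exp (α s : ℝ) : weight α s * Real.exp (α * s ^ 2 / 4) = 1 := by
  rw [weight, ← Real.exp_add, Real.exp_eq_one_iff]
  ring

theorem weight_sq (α s : ℝ) : weight α s ^ 2 = Real.exp (-(α / 2) * s ^ 2) := by
  rw [weight, ← Real.exp_nat_mul]
  congr 1
  push_cast
  ring

theorem hasDerivAt_weight (α s : ℝ) :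
    HasDerivAt (weight α) (-(α / 2 * s) * weight α s) s :=
  (hasDerivAt_gaussian (α / 4) s).congr_deriv (by rw [weight]; ring)

theorem continuous_weight (α : ℝ) : Continuous (weight α) := by
  unfold weight
  fun_prop

theorem ratio_mul_curvature {c : ℝ} (hc : 0 < c) (α s : ℝ) :
    ratio α c s * curvature α c s = torsion α s := by
  unfold ratio curvature torsion
  have := weight_mul_exp α s
  generalize Real.exp (α * s ^ 2 / 4) = e at this ⊢
  field_simp
  linear_combination (-beta α * s) * this

theorem ratioSnd_mul_curvature {c : ℝ} (hc : 0 < c) (α s : ℝ) :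
    ratioSnd α c s * curvature α c s = ratioDeriv α c s := by
  unfold ratioSnd curvature ratioDeriv
  have := weight_mul_exp α s
  generalize Real.exp (α * s ^ 2 / 4) = e at this ⊢
  field_simp
  linear_combination (-beta α * (2 - α * s ^ 2) * weight α s) * this

theorem hasDerivAt_ratio (α c s : ℝ) : HasDerivAt (ratio α c) (ratioDeriv α c s) s := by
  unfold ratio ratioDeriv
  refine (((hasDerivAt_id s).mul (hasDerivAt_weight α s)).const_mul _).congr_deriv ?_
  simp only [id]
  ring

theorem hasDerivAt_ratioSnd (α c s : ℝ) : HasDerivAt (ratioSnd α c) (ratioSndDeriv α c s) s := by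
  unfold ratioSnd ratioSndDeriv
  refine ((((((hasDerivAt_id s).pow 2).const_mul α).div_const 2).const_sub 1).mul
    ((hasDerivAt_weight α s).pow 2)|>.const_mul _).congr_deriv ?_
  simp
  ring

section Bounds

variable {α c s : ℝ}

theorem abs_torsion_le (hs : 0 ≤ s) : |torsion α s| ≤ s / 2 := by
  rw [torsion, abs_div, abs_neg, abs_mul, abs_of_nonneg (beta_nonneg α), abs_of_nonneg hs,
    abs_two]
  nlinarith [beta_le_one α]

theorem abs_ratio_eq (hc : 0 < c) (hs : 0 ≤ s) :
    |ratio α c s| = beta α / c / 2 * (s * weight α s) := by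
  have := weight_pos α s
  have := beta_nonneg α
  rw [ratio, abs_mul, abs_neg, abs_of_nonneg (by positivity), abs_of_nonneg (by positivity)]

theorem abs_one_sub_le (h0 : 0 < α) (h1 : α ≤ 1) (hs : 1 ≤ s) : |1 - α * s ^ 2 / 2| ≤ s ^ 2 := by
  have h2 : 1 ≤ s ^ 2 := one_le_pow₀ hs
  rw [abs_le]
  constructor <;> nlinarith

theorem abs_two_sub_le (h0 : 0 < α) (h1 : α ≤ 1) (hs : 1 ≤ s) :
    |2 - α * s ^ 2 / 2| ≤ 2 * s ^ 2 := by
  have h2 : 1 ≤ s ^ 2 := one_le_pow₀ hs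
  rw [abs_le]
  constructor <;> nlinarith

theorem abs_ratioDeriv_le (h0 : 0 < α) (h1 : α ≤ 1) (hc : 0 < c) (hs : 1 ≤ s) :
    |ratioDeriv α c s| ≤ beta α / c / 2 * (s ^ 2 * weight α s) := by
  have := weight_pos α s
  have := beta_nonneg α
  rw [ratioDeriv, abs_mul, abs_neg, abs_of_nonneg (by positivity), abs_mul,
    abs_of_pos (weight_pos α s)]
  gcongr
  exact abs_one_sub_le h0 h1 hs

theorem abs_ratioSnd_le (h0 : 0 < α) (h1 : α ≤ 1) (hc : 0 < c) (hs : 1 ≤ s) :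
    |ratioSnd α c s| ≤ beta α / c / c / 2 * (s ^ 2 * weight α s ^ 2) := by
  have := weight_pos α s
  have := beta_nonneg α
  rw [ratioSnd, abs_mul, abs_neg, abs_of_nonneg (by positivity), abs_mul,
    abs_of_pos (pow_pos (weight_pos α s) 2)]
  gcongr
  exact abs_one_sub_le h0 h1 hs

theorem abs_ratioSndDeriv_le (h0 : 0 < α) (h1 : α ≤ 1) (hc : 0 < c) (hs : 1 ≤ s) :
    |ratioSndDeriv α c s| ≤ beta α / c / c * (s ^ 3 * weight α s ^ 2) := by
  have := weight_pos α s
  have := beta_nonneg α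
  have hs0 : 0 < s := by linarith
  rw [ratioSndDeriv, abs_mul, abs_of_nonneg (by positivity), abs_mul, abs_mul,
    abs_of_pos (pow_pos (weight_pos α s) 2), abs_of_pos (mul_pos h0 hs0)]
  calc beta α / c / c / 2 * (α * s * |2 - α * s ^ 2 / 2| * weight α s ^ 2)
      ≤ beta α / c / c / 2 * (1 * s * (2 * s ^ 2) * weight α s ^ 2) := by
        gcongr
        exact abs_two_sub_le h0 h1 hs
    _ = beta α / c / c * (s ^ 3 * weight α s ^ 2) := by ring

theorem abs_ratio_mul_torsion_le (hc : 0 < c) (hs : 0 ≤ s) :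
    |ratio α c s * torsion α s| ≤ beta α / c / 4 * (s ^ 2 * weight α s) := by
  have := weight_pos α s
  have := beta_nonneg α
  rw [abs_mul, abs_ratio_eq hc hs]
  calc _ ≤ beta α / c / 2 * (s * weight α s) * (s / 2) := by
        gcongr
        exact abs_torsion_le hs
    _ = _ := by ring

theorem sq_beta_div_le (hc : 0 < c) : (beta α / c) ^ 2 ≤ beta α / c / c := by
  have := beta_nonneg α
  rw [div_div, div_pow, ← sq]
  gcongr
  nlinarith [beta_le_one α]

theorem hasDerivAt_dominator_fst (h0 : 0 < α) (K s : ℝ) :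
    HasDerivAt (fun s => K * ((s + 2 / α) * weight α s))
      (-(K * ((α / 2 * s ^ 2 + s - 1) * weight α s))) s := by
  refine ((((hasDerivAt_id s).add_const (2 / α)).mul (hasDerivAt_weight α s)).const_mul
    K).congr_deriv ?_
  simp only [id]
  field_simp
  ring

theorem hasDerivAt_dominator_snd (h0 : 0 < α) (K s : ℝ) :
    HasDerivAt (fun s => K * ((s ^ 2 + 2 / α) * weight α s ^ 2))
      (-(K * (α * s ^ 3 * weight α s ^ 2))) s := by
  refine (((((hasDerivAt_id s).pow 2).add_const (2 / α)).mul
    ((hasDerivAt_weight α s).pow 2)).const_mul K).congr_deriv ?_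
  simp
  field_simp
  ring

theorem tendsto_dominator_fst (h0 : 0 < α) (K : ℝ) :
    Tendsto (fun s => K * ((s + 2 / α) * weight α s)) atTop (𝓝 0) := by
  have h := ((tendsto_pow_mul_gaussian (κ := α / 4) (by positivity) 1).add
    ((tendsto_pow_mul_gaussian (κ := α / 4) (by positivity) 0).const_mul (2 / α))).const_mul K
  simp only [mul_zero, add_zero] at h
  refine h.congr fun s => ?_
  rw [weight]
  ring

theorem tendsto_dominator_snd (h0 : 0 < α) (K : ℝ) :
    Tendsto (fun s => K * ((s ^ 2 + 2 / α) * weight α s ^ 2)) atTop (𝓝 0) := by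
  have h := ((tendsto_pow_mul_gaussian (κ := α / 2) (by positivity) 2).add
    ((tendsto_pow_mul_gaussian (κ := α / 2) (by positivity) 0).const_mul (2 / α))).const_mul K
  simp only [mul_zero, add_zero] at h
  refine h.congr fun s => ?_
  rw [weight_sq]
  ring

theorem dominator_fst_le (h0 : 0 < α) (h1 : α ≤ 1) {K : ℝ} (hK : 0 ≤ K) (hs : 1 ≤ s) :
    K * ((s + 2 / α) * weight α s) ≤ 3 * K / α * (s * weight α s) := by
  have := weight_pos α s
  have hsα : s + 2 / α ≤ 3 / α * s := by
    have : 1 ≤ 1 / α := by rw [le_div_iff₀ h0]; linarith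
    have e1 : 2 / α = 2 * (1 / α) := by ring
    have e2 : 3 / α * s = 3 * (1 / α) * s := by ring
    rw [e1, e2]
    nlinarith [mul_nonneg (sub_nonneg.2 this) (sub_nonneg.2 hs)]
  calc _ ≤ K * ((3 / α * s) * weight α s) := by gcongr
    _ = _ := by ring

theorem dominator_snd_le (h0 : 0 < α) (h1 : α ≤ 1) {K : ℝ} (hK : 0 ≤ K) (hs : 1 ≤ s) :
    K * ((s ^ 2 + 2 / α) * weight α s ^ 2) ≤ 3 * K / α * (s ^ 2 * weight α s ^ 2) := by
  have := weight_pos α s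
  have hsα : s ^ 2 + 2 / α ≤ 3 / α * s ^ 2 := by
    have : 1 ≤ 1 / α := by rw [le_div_iff₀ h0]; linarith
    have hs2 : 1 ≤ s ^ 2 := one_le_pow₀ hs
    have e1 : 2 / α = 2 * (1 / α) := by ring
    have e2 : 3 / α * s ^ 2 = 3 * (1 / α) * s ^ 2 := by ring
    rw [e1, e2]
    nlinarith [mul_nonneg (sub_nonneg.2 this) (sub_nonneg.2 hs2)]
  calc _ ≤ K * ((3 / α * s ^ 2) * weight α s ^ 2) := by gcongr
    _ = _ := by ring

end Bounds

/-- The tail `∫_x^∞ τ² / k`. -/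
noncomputable def torsionTail (α c x : ℝ) : ℝ :=
  beta α ^ 2 / (4 * c) * ∫ s in Ioi x, s ^ 2 * weight α s

theorem hasDerivAt_torsionTail {α c : ℝ} (h0 : 0 < α) (x : ℝ) :
    HasDerivAt (torsionTail α c) (-(ratio α c x * torsion α x)) x := by
  have hF : Continuous fun s => s ^ 2 * weight α s := (continuous_pow 2).mul (continuous_weight α)
  refine ((hasDerivAt_integral_Ioi hF
    (integrable_sq_mul_gaussian (by positivity)) x).const_mul _).congr_deriv ?_
  rw [ratio, torsion]
  ring

theorem tendsto_torsionTail {α : ℝ} (h0 : 0 < α) (c : ℝ) :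
    Tendsto (torsionTail α c) atTop (𝓝 0) := by
  have h := (tendsto_integral_Ioi_zero (integrable_sq_mul_gaussian
    (κ := α / 4) (by positivity))).const_mul (beta α ^ 2 / (4 * c))
  rwa [mul_zero] at h

theorem exists_polar (w : ℂ) : ∃ φ ∈ Ico 0 (2 * Real.pi),
    w = ‖w‖ * Complex.exp (φ * Complex.I) := by
  by_cases h : 0 ≤ w.arg
  · exact ⟨w.arg, ⟨h, by linarith [w.arg_le_pi, Real.pi_pos]⟩,
      (Complex.norm_mul_exp_arg_mul_I w).symm⟩
  · refine ⟨w.arg + 2 * Real.pi, ⟨by linarith [w.neg_pi_lt_arg], by linarith⟩, ?_⟩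
    push_cast
    rw [add_mul, Complex.exp_add, Complex.exp_two_pi_mul_I, mul_one]
    exact (Complex.norm_mul_exp_arg_mul_I w).symm

/-! ### Asymptotics of the scalar system -/

theorem exists_tendsto_of_first_order {E : Type*} [NormedAddCommGroup E] [NormedSpace ℝ E]
    [CompleteSpace E] {α c : ℝ} (h0 : 0 < α) (h1 : α ≤ 1) (hc : 0 < c) {X Y W' : ℝ → E}
    (hW : ∀ s, HasDerivAt (fun s => X s - Y s) (W' s) s)
    (hW' : ∀ s, 1 ≤ s → ‖W' s‖ ≤ beta α / c * (s ^ 2 * weight α s))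
    (hY : ∀ s, 1 ≤ s → ‖Y s‖ ≤ |ratio α c s|) :
    ∃ L, Tendsto X atTop (𝓝 L) ∧
      ∀ s, 1 ≤ s → ‖X s - L‖ ≤ 7 * (beta α / c) / α ^ 2 * (s * weight α s) := by
  have hb := beta_nonneg α
  have hα : 1 ≤ 1 / α ^ 2 := by
    rw [le_div_iff₀ (by positivity)]
    nlinarith
  obtain ⟨L, hL, hLW⟩ := exists_tendsto_of_norm_deriv_le hW
    (hasDerivAt_dominator_fst h0 (2 * (beta α / c) / α)) (x₀ := 1) (fun s hs => by
      refine (hW' s hs).trans ?_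
      have hw := weight_pos α s
      rw [neg_neg]
      calc beta α / c * (s ^ 2 * weight α s)
          = 2 * (beta α / c) / α * ((α / 2 * s ^ 2 + 0) * weight α s) := by
            field_simp
            ring
        _ ≤ _ := by
            rw [add_sub_assoc]
            gcongr
            linarith) (tendsto_dominator_fst h0 _)
  have hYs : ∀ s, 1 ≤ s → ‖Y s‖ ≤ beta α / c / 2 * (s * weight α s) := fun s hs =>
    (hY s hs).trans_eq (abs_ratio_eq hc (by linarith))
  refine ⟨L, ?_, fun s hs => ?_⟩
  · have hY0 : Tendsto Y atTop (𝓝 0) := by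
      have h := ((tendsto_pow_mul_gaussian (κ := α / 4) (by positivity) 1).const_mul
        (beta α / c / 2))
      rw [mul_zero] at h
      refine squeeze_zero_norm' ?_ h
      filter_upwards [eventually_ge_atTop 1] with s hs
      rw [pow_one]
      exact hYs s hs
    simpa using hL.add hY0
  · have hw := weight_pos α s
    have hs0 : 0 < s := by linarith
    have e1 := (hLW s hs).trans (dominator_fst_le h0 h1 (by positivity) hs)
    have e2 := hYs s hs
    have e3 : ‖X s - L‖ ≤ ‖L - (X s - Y s)‖ + ‖Y s‖ := by
      rw [← norm_neg (L - _)]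
      refine (norm_add_le _ _).trans' (le_of_eq ?_)
      congr 1
      abel
    have e4 : beta α / c / 2 * (s * weight α s) ≤
        1 / α ^ 2 * (beta α / c * (s * weight α s)) := by
      have : 0 ≤ beta α / c * (s * weight α s) := by positivity
      nlinarith
    calc ‖X s - L‖ ≤ 3 * (2 * (beta α / c) / α) / α * (s * weight α s) +
        1 / α ^ 2 * (beta α / c * (s * weight α s)) := by linarith
      _ = _ := by
        field_simp
        ring

namespace FrenetSystem

variable {α c : ℝ} {a b d : ℝ → ℝ}

theorem hasDerivAt_const_mul_Phi (α c s : ℝ) :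
    HasDerivAt (fun s => c * Phi α s) (curvature α c s) s :=
  (hasDerivAt_Phi α s).const_mul c

theorem abs_le_one_of_sum_sq {x y z : ℝ} (h : x ^ 2 + y ^ 2 + z ^ 2 = 1) :
    |x| ≤ 1 ∧ |y| ≤ 1 ∧ |z| ≤ 1 := by
  refine ⟨?_, ?_, ?_⟩ <;> refine abs_le_one_iff_mul_self_le_one.2 ?_ <;>
    nlinarith [sq_nonneg x, sq_nonneg y, sq_nonneg z]

theorem exists_tendsto_rotating (H : FrenetSystem (curvature α c) (torsion α) a b d)
    (hn : ∀ x, a x ^ 2 + b x ^ 2 + d x ^ 2 = 1) (h0 : 0 < α) (h1 : α ≤ 1) (hc : 0 < c) :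
    ∃ w : ℂ, Tendsto (rotating (fun s => c * Phi α s) a b) atTop (𝓝 w) ∧
      ∀ s, 1 ≤ s → ‖rotating (fun s => c * Phi α s) a b s - w‖ ≤
        7 * (beta α / c) / α ^ 2 * (s * weight α s) := by
  refine exists_tendsto_of_first_order h0 h1 hc
    (H.hasDerivAt_rotating_sub (hasDerivAt_const_mul_Phi α c) (hasDerivAt_ratio α c)
      (ratio_mul_curvature hc α)) (fun s hs => ?_) (fun s hs => ?_)
  · obtain ⟨-, hb1, hd1⟩ := abs_le_one_of_sum_sq (hn s)
    rw [norm_mul, Complex.norm_exp_ofReal_mul_I, one_mul]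
    norm_cast
    rw [Real.norm_eq_abs]
    have hw := weight_pos α s
    have hb := beta_nonneg α
    calc |-(ratioDeriv α c s) * d s + ratio α c s * torsion α s * b s|
        ≤ |ratioDeriv α c s| * |d s| + |ratio α c s * torsion α s| * |b s| := by
          refine (abs_add_le _ _).trans_eq ?_
          rw [abs_mul, abs_neg, abs_mul (_ * _)]
      _ ≤ beta α / c / 2 * (s ^ 2 * weight α s) * 1 +
          beta α / c / 4 * (s ^ 2 * weight α s) * 1 := by
          gcongr
          · exact abs_ratioDeriv_le h0 h1 hc hs
          · exact abs_ratio_mul_torsion_le hc (by linarith)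
      _ ≤ _ := by
          have : 0 ≤ beta α / c * (s ^ 2 * weight α s) := by positivity
          linarith
  · obtain ⟨-, -, hd1⟩ := abs_le_one_of_sum_sq (hn s)
    rw [norm_mul, Complex.norm_exp_ofReal_mul_I, one_mul]
    norm_cast
    rw [Real.norm_eq_abs, abs_mul]
    exact mul_le_of_le_one_right (abs_nonneg _) hd1

theorem exists_tendsto_binormal (H : FrenetSystem (curvature α c) (torsion α) a b d)
    (hn : ∀ x, a x ^ 2 + b x ^ 2 + d x ^ 2 = 1) (h0 : 0 < α) (h1 : α ≤ 1) (hc : 0 < c) :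
    ∃ B : ℝ, Tendsto d atTop (𝓝 B) ∧
      ∀ s, 1 ≤ s → ‖d s - B‖ ≤ 7 * (beta α / c) / α ^ 2 * (s * weight α s) := by
  have hd := H.hasDerivAt_add_mul (hasDerivAt_ratio α c) (ratio_mul_curvature hc α)
  refine exists_tendsto_of_first_order (Y := fun s => -(ratio α c s * a s)) h0 h1 hc
    (fun s => by simpa only [sub_neg_eq_add] using hd s) (fun s hs => ?_) (fun s hs => ?_)
  · obtain ⟨ha1, -, -⟩ := abs_le_one_of_sum_sq (hn s)
    have hw := weight_pos α s
    have hb := beta_nonneg α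
    rw [Real.norm_eq_abs, abs_mul]
    calc |ratioDeriv α c s| * |a s| ≤ beta α / c / 2 * (s ^ 2 * weight α s) * 1 := by
          gcongr
          exact abs_ratioDeriv_le h0 h1 hc hs
      _ ≤ _ := by
          have : 0 ≤ beta α / c * (s ^ 2 * weight α s) := by positivity
          linarith
  · obtain ⟨ha1, -, -⟩ := abs_le_one_of_sum_sq (hn s)
    rw [norm_neg, Real.norm_eq_abs, abs_mul]
    exact mul_le_of_le_one_right (abs_nonneg _) ha1

/-- The second normal form of the system, up to terms of second order. -/
noncomputable def normalForm (α c : ℝ) (a b d : ℝ → ℝ) (w : ℂ) (s : ℝ) : ℂ :=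
  rotating (fun s => c * Phi α s) a b s
    - Complex.exp ((c * Phi α s : ℝ) * Complex.I) * (ratio α c s * d s)
    - Complex.exp ((c * Phi α s : ℝ) * Complex.I) * (ratioSnd α c s * d s) * Complex.I
    - (torsionTail α c s) * (w * Complex.I / 2)
    - Complex.exp ((c * Phi α s : ℝ) * Complex.I) * (a s - b s * Complex.I)
      * (ratio α c s) ^ 2 / 4

theorem norm_sub_mul_I_le {x y : ℝ} (h : x ^ 2 + y ^ 2 ≤ 1) : ‖(x : ℂ) - y * Complex.I‖ ≤ 1 := by
  have : (x : ℂ) - y * Complex.I = x + ((-y : ℝ) : ℂ) * Complex.I := by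
    push_cast
    ring
  rw [this, Complex.norm_add_mul_I]
  exact Real.sqrt_le_one.2 (by rwa [neg_sq])

theorem norm_normalForm_sub_le (H : FrenetSystem (curvature α c) (torsion α) a b d)
    (hn : ∀ x, a x ^ 2 + b x ^ 2 + d x ^ 2 = 1) (h0 : 0 < α) (h1 : α ≤ 1) (hc : 0 < c) {w : ℂ}
    (hw : Tendsto (rotating (fun s => c * Phi α s) a b) atTop (𝓝 w))
    (hw' : ∀ s, 1 ≤ s → ‖rotating (fun s => c * Phi α s) a b s - w‖ ≤
        7 * (beta α / c) / α ^ 2 * (s * weight α s)) {s : ℝ} (hs : 1 ≤ s) :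
    ‖w - normalForm α c a b d w s‖ ≤
      9 * (beta α / c / c) / α ^ 4 * (s ^ 2 * weight α s ^ 2) := by
  have hb := beta_nonneg α
  have hα : 1 ≤ 1 / α ^ 2 := by
    rw [le_div_iff₀ (by positivity)]
    nlinarith
  have hder := H.hasDerivAt_rotating_sub_second (hasDerivAt_const_mul_Phi α c)
    (hasDerivAt_ratio α c) (ratio_mul_curvature hc α) (hasDerivAt_ratioSnd α c)
    (ratioSnd_mul_curvature hc α) (hasDerivAt_torsionTail (c := c) h0) w
  obtain ⟨L, hL, hLW⟩ := exists_tendsto_of_norm_deriv_le hder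
    (hasDerivAt_dominator_snd h0 (3 * (beta α / c / c) / α ^ 3)) (x₀ := 1) (fun s hs => by
      obtain ⟨-, hb1, hd1⟩ := abs_le_one_of_sum_sq (hn s)
      have hz := norm_sub_mul_I_le (x := a s) (y := b s) (by nlinarith [hn s, sq_nonneg (d s)])
      have hW := weight_pos α s
      have hs0 : 0 < s := by linarith
      set V := beta α / c / c * (s ^ 3 * weight α s ^ 2) with hV
      have hV0 : 0 ≤ V := by positivity
      have hsq := sq_beta_div_le (α := α) hc
      have t1 : ‖Complex.exp ((c * Phi α s : ℝ) * Complex.I) * ((-(ratioSndDeriv α c s) * d s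
          + ratioSnd α c s * torsion α s * b s) * Complex.I)‖ ≤ 5 / 4 * V := by
        rw [norm_mul, Complex.norm_exp_ofReal_mul_I, one_mul, norm_mul, Complex.norm_I, mul_one]
        norm_cast
        rw [Real.norm_eq_abs]
        calc |-(ratioSndDeriv α c s) * d s + ratioSnd α c s * torsion α s * b s|
            ≤ |ratioSndDeriv α c s| * |d s| + |ratioSnd α c s| * |torsion α s| * |b s| := by
              refine (abs_add_le _ _).trans_eq ?_
              rw [abs_mul, abs_neg, abs_mul (_ * _), abs_mul (ratioSnd α c s)]
          _ ≤ V * 1 + beta α / c / c / 2 * (s ^ 2 * weight α s ^ 2) * (s / 2) * 1 := by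
              gcongr
              · exact abs_ratioSndDeriv_le h0 h1 hc hs
              · exact abs_ratioSnd_le h0 h1 hc hs
              · exact abs_torsion_le hs0.le
          _ = _ := by
              rw [hV]
              ring
      have t2 : ‖(ratio α c s * torsion α s : ℂ) *
          (rotating (fun s => c * Phi α s) a b s - w) * Complex.I / 2‖ ≤ 7 / 8 * (V / α ^ 2) := by
        rw [norm_div, norm_mul, norm_mul, Complex.norm_I, mul_one, ← Complex.ofReal_mul,
          Complex.norm_real, Real.norm_eq_abs, Complex.norm_ofNat]
        calc |ratio α c s * torsion α s| * ‖rotating (fun s => c * Phi α s) a b s - w‖ / 2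
            ≤ (beta α / c / 4 * (s ^ 2 * weight α s)) *
              (7 * (beta α / c) / α ^ 2 * (s * weight α s)) / 2 := by
              gcongr
              · exact abs_ratio_mul_torsion_le hc hs0.le
              · exact hw' s hs
          _ = 7 / 8 * ((beta α / c) ^ 2 * (s ^ 3 * weight α s ^ 2) / α ^ 2) := by ring
          _ ≤ _ := by
              rw [hV]
              gcongr
      have t3 : ‖Complex.exp ((c * Phi α s : ℝ) * Complex.I) * (a s - b s * Complex.I) *
          (ratio α c s * ratioDeriv α c s) / 2‖ ≤ 1 / 8 * V := by
        rw [norm_div, norm_mul, norm_mul, Complex.norm_exp_ofReal_mul_I, one_mul,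
          ← Complex.ofReal_mul, Complex.norm_real, Real.norm_eq_abs, Complex.norm_ofNat, abs_mul]
        calc ‖(a s - b s * Complex.I : ℂ)‖ * (|ratio α c s| * |ratioDeriv α c s|) / 2
            ≤ 1 * (beta α / c / 2 * (s * weight α s) *
              (beta α / c / 2 * (s ^ 2 * weight α s))) / 2 := by
              gcongr
              · exact (abs_ratio_eq hc hs0.le).le
              · exact abs_ratioDeriv_le h0 h1 hc hs
          _ = 1 / 8 * ((beta α / c) ^ 2 * (s ^ 3 * weight α s ^ 2)) := by ring
          _ ≤ _ := by
              rw [hV]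
              gcongr
      have t4 : ‖Complex.exp ((c * Phi α s : ℝ) * Complex.I) * ((ratio α c s) ^ 2 *
          torsion α s * d s) * Complex.I / 4‖ ≤ 1 / 32 * V := by
        rw [norm_div, norm_mul, norm_mul, Complex.norm_exp_ofReal_mul_I, one_mul,
          Complex.norm_I, mul_one, Complex.norm_ofNat]
        norm_cast
        rw [Real.norm_eq_abs, abs_mul, abs_mul, abs_pow]
        calc |ratio α c s| ^ 2 * |torsion α s| * |d s| / 4
            ≤ (beta α / c / 2 * (s * weight α s)) ^ 2 * (s / 2) * 1 / 4 := by
              gcongr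
              · exact (abs_ratio_eq hc hs0.le).le
              · exact abs_torsion_le hs0.le
          _ = 1 / 32 * ((beta α / c) ^ 2 * (s ^ 3 * weight α s ^ 2)) := by ring
          _ ≤ _ := by
              rw [hV]
              gcongr
      have hVα : V ≤ V / α ^ 2 := by
        rw [div_eq_mul_one_div]
        exact le_mul_of_one_le_right hV0 hα
      refine (norm_add_le _ _).trans ((add_le_add_left ((norm_sub_le _ _).trans
        (add_le_add_left (norm_sub_le _ _) _)) _).trans ?_)
      rw [neg_neg]
      calc _ ≤ 5 / 4 * V + 7 / 8 * (V / α ^ 2) + 1 / 8 * V + 1 / 32 * V :=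
            add_le_add (add_le_add (add_le_add t1 t2) t3) t4
        _ ≤ 3 * (V / α ^ 2) := by linarith
        _ = _ := by
            rw [hV]
            field_simp) (tendsto_dominator_snd h0 _)
  have hLw : L = w := by
    refine tendsto_nhds_unique hL ?_
    have hE : ∀ n : ℕ, Tendsto (fun s => s ^ n * weight α s) atTop (𝓝 0) := fun n =>
      tendsto_pow_mul_gaussian (by positivity) n
    have hr : Tendsto (ratio α c) atTop (𝓝 0) := by
      have := (hE 1).const_mul (-(beta α / c / 2))
      simp only [mul_zero, pow_one] at this
      exact this
    have hp : Tendsto (ratioSnd α c) atTop (𝓝 0) := by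
      have := (((hE 0).mul (hE 0)).sub (((hE 1).mul (hE 1)).const_mul (α / 2))).const_mul
        (-(beta α / c / c / 2))
      simp only [mul_zero, sub_zero] at this
      refine this.congr fun s => ?_
      rw [ratioSnd]
      ring
    have hR : ∀ {u : ℝ → ℝ}, Tendsto u atTop (𝓝 0) → Tendsto (fun s => (u s : ℂ)) atTop (𝓝 0) :=
      fun hu => by exact_mod_cast (Complex.continuous_ofReal.tendsto 0).comp hu
    have hbd : ∀ {u v : ℝ → ℂ}, Tendsto u atTop (𝓝 0) → (∀ s, ‖v s‖ ≤ 1) →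
        Tendsto (fun s => v s * u s) atTop (𝓝 0) := fun {u v} hu hv =>
      squeeze_zero_norm (a := fun s => ‖u s‖) (fun s => by
        rw [norm_mul]
        exact mul_le_of_le_one_left (norm_nonneg _) (hv s)) (by simpa using hu.norm)
    have hed : ∀ s, ‖Complex.exp ((c * Phi α s : ℝ) * Complex.I) * d s‖ ≤ 1 := fun s => by
      rw [norm_mul, Complex.norm_exp_ofReal_mul_I, one_mul, Complex.norm_real]
      exact (abs_le_one_of_sum_sq (hn s)).2.2
    have hez : ∀ s, ‖Complex.exp ((c * Phi α s : ℝ) * Complex.I) * (a s - b s * Complex.I)‖ ≤ 1 :=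
      fun s => by
        rw [norm_mul, Complex.norm_exp_ofReal_mul_I, one_mul]
        exact norm_sub_mul_I_le (by nlinarith [hn s, sq_nonneg (d s)])
    have hr2 : Tendsto (fun s => (ratio α c s : ℂ) ^ 2) atTop (𝓝 0) := by
      simpa using (hR hr).pow 2
    have hlim := (((hw.sub (hbd (hR hr) hed)).sub ((hbd (hR hp) hed).mul_const Complex.I)).sub
      ((hR (tendsto_torsionTail h0 c)).mul_const (w * Complex.I / 2))).sub
      ((hbd hr2 hez).div_const 4)
    simp only [zero_mul, sub_zero, zero_div] at hlim
    refine hlim.congr fun s => ?_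
    ring
  subst hLw
  refine (hLW s hs).trans ((dominator_snd_le h0 h1 (by positivity) hs).trans_eq ?_)
  field_simp
  ring

end FrenetSystem

theorem profileExpansion_eq {α c : ℝ} (ρ B φ x : ℝ) :
    profileExpansion α c ρ B φ x = ρ * Real.cos (c * Phi α x - φ) + ratio α c x * B
      + ρ / 2 * Real.sin (c * Phi α x - φ) * torsionTail α c x := by
  have e1 : ∀ s : ℝ, Real.exp (-α * s ^ 2 / 4) = weight α s := fun s => by
    rw [weight]
    congr 1
    ring
  unfold profileExpansion torsionTail ratio
  simp only [e1]
  ring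

theorem exp_neg_mul_polar {w : ℂ} {φ : ℝ} (hφ : w = ‖w‖ * Complex.exp (φ * Complex.I)) (θ : ℝ) :
    Complex.exp (-(θ * Complex.I)) * w =
      (‖w‖ * Real.cos (θ - φ) : ℝ) - (‖w‖ * Real.sin (θ - φ) : ℝ) * Complex.I := by
  have h : Complex.exp (-(θ * Complex.I)) * w =
      ‖w‖ * Complex.exp (((-(θ - φ) : ℝ) : ℂ) * Complex.I) := by
    conv_lhs => rw [hφ]
    rw [mul_left_comm, ← Complex.exp_add]
    congr 2
    push_cast
    ring
  rw [h, Complex.exp_mul_I, ← Complex.ofReal_cos, ← Complex.ofReal_sin, Real.cos_neg, Real.sin_neg]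
  push_cast
  ring

theorem abs_re_exp_mul_le (θ : ℝ) (z : ℂ) :
    |(Complex.exp (-(θ * Complex.I)) * z).re| ≤ ‖z‖ := by
  refine (Complex.abs_re_le_norm _).trans_eq ?_
  rw [norm_mul, show -((θ : ℂ) * Complex.I) = ((-θ : ℝ) : ℂ) * Complex.I by push_cast; ring,
    Complex.norm_exp_ofReal_mul_I, one_mul]

namespace FrenetSystem

variable {α c : ℝ} {a b d : ℝ → ℝ}

/-- Asymptotics at `+∞` of the first component of a normalized solution. -/
theorem asymptotics (H : FrenetSystem (curvature α c) (torsion α) a b d)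
    (hn : ∀ x, a x ^ 2 + b x ^ 2 + d x ^ 2 = 1) (h0 : 0 < α) (h1 : α ≤ 1) (hc : 0 < c) :
    ∃ ρ B φ : ℝ, (ρ ∈ Icc (0 : ℝ) 1 ∧ B ∈ Icc (-1 : ℝ) 1 ∧ φ ∈ Ico 0 (2 * Real.pi)) ∧
      (∀ x, 1 ≤ x → |a x - profileExpansion α c ρ B φ x| ≤
        beta α / (α ^ 5 * c ^ 2) * (13 * (x ^ 2 * Real.exp (-α * x ^ 2 / 2)))) ∧
      Tendsto (fun x => a x - ρ * Real.cos (c * Phi α x - φ)) atTop (𝓝 0) := by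
  obtain ⟨w, hw, hw'⟩ := H.exists_tendsto_rotating hn h0 h1 hc
  obtain ⟨B, hB, hB'⟩ := H.exists_tendsto_binormal hn h0 h1 hc
  obtain ⟨φ, hφ, hwφ⟩ := exists_polar w
  have hw1 : ‖w‖ ≤ 1 := le_of_tendsto' hw.norm fun s =>
    norm_exp_mul_le (by nlinarith [hn s, sq_nonneg (d s)])
  have hB1 : |B| ≤ 1 := le_of_tendsto' hB.abs fun s => (abs_le_one_of_sum_sq (hn s)).2.2
  have hee : ∀ θ : ℝ, Complex.exp (-(θ * Complex.I)) * Complex.exp (θ * Complex.I) = 1 :=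
    fun θ => by rw [← Complex.exp_add, neg_add_cancel, Complex.exp_zero]
  refine ⟨‖w‖, B, φ, ⟨⟨norm_nonneg _, hw1⟩, abs_le.1 hB1, hφ⟩, fun x hx => ?_, ?_⟩
  · have hW := weight_pos α x
    have hb := beta_nonneg α
    have hx0 : 0 < x := by linarith
    have hα : 1 / α ^ 2 ≤ 1 / α ^ 5 :=
      one_div_le_one_div_of_le (by positivity) (pow_le_pow_of_le_one h0.le h1 (by norm_num))
    have hα4 : 1 / α ^ 4 ≤ 1 / α ^ 5 :=
      one_div_le_one_div_of_le (by positivity) (pow_le_pow_of_le_one h0.le h1 (by norm_num))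
    have hα1 : 1 ≤ 1 / α ^ 5 := by
      rw [le_div_iff₀ (by positivity), one_mul]
      exact pow_le_one₀ h0.le h1
    have hN := H.norm_normalForm_sub_le hn h0 h1 hc hw hw' hx
    set θ := c * Phi α x with hθ
    set N := normalForm α c a b d w x with hNdef
    have hid : (a x : ℂ) + b x * Complex.I =
        Complex.exp (-(θ * Complex.I)) * w + Complex.exp (-(θ * Complex.I)) * (N - w)
        + (ratio α c x * d x : ℝ) + (ratioSnd α c x * d x : ℝ) * Complex.I
        + (torsionTail α c x / 2 : ℝ) * (Complex.exp (-(θ * Complex.I)) * w) * Complex.I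
        + (ratio α c x ^ 2 / 4 : ℝ) * (a x - b x * Complex.I) := by
      rw [hNdef, normalForm, rotating, ← hθ]
      push_cast
      have := hee θ
      linear_combination (-((a x : ℂ) + b x * Complex.I) + ratio α c x * d x
        + ratioSnd α c x * d x * Complex.I
        + ratio α c x ^ 2 / 4 * (a x - b x * Complex.I)) * this
    have hre := congrArg Complex.re hid
    rw [exp_neg_mul_polar hwφ θ] at hre
    simp only [Complex.add_re, Complex.sub_re, Complex.mul_re, Complex.ofReal_re, Complex.ofReal_im,
      Complex.I_re, Complex.I_im, Complex.mul_im, Complex.sub_im, mul_zero, zero_mul, mul_one,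
      add_zero, sub_zero, zero_sub] at hre
    have hkey : a x - profileExpansion α c ‖w‖ B φ x =
        (Complex.exp (-(θ * Complex.I)) * (N - w)).re + ratio α c x * (d x - B)
          + ratio α c x ^ 2 / 4 * a x := by
      rw [profileExpansion_eq, ← hθ, Complex.mul_re, Complex.sub_re, Complex.sub_im]
      linear_combination hre
    set G := x ^ 2 * weight α x ^ 2 with hG
    have hG0 : 0 ≤ G := by positivity
    have hexp : x ^ 2 * Real.exp (-α * x ^ 2 / 2) = G := by
      rw [hG, weight_sq]
      congr 2
      ring
    have hsq := sq_beta_div_le (α := α) hc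
    have hU : 0 ≤ beta α / c / c * G := by positivity
    have t1 : |(Complex.exp (-(θ * Complex.I)) * (N - w)).re| ≤
        9 * (beta α / c / c * G * (1 / α ^ 5)) := by
      refine (abs_re_exp_mul_le θ _).trans ?_
      rw [norm_sub_rev]
      refine hN.trans ?_
      calc _ = 9 * (beta α / c / c * G * (1 / α ^ 4)) := by ring
        _ ≤ _ := by gcongr
    have t2 : |ratio α c x * (d x - B)| ≤ 7 / 2 * (beta α / c / c * G * (1 / α ^ 5)) := by
      rw [abs_mul]
      calc |ratio α c x| * |d x - B| ≤ beta α / c / 2 * (x * weight α x) *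
            (7 * (beta α / c) / α ^ 2 * (x * weight α x)) := by
            gcongr
            · exact (abs_ratio_eq hc hx0.le).le
            · exact hB' x hx
        _ = 7 / 2 * ((beta α / c) ^ 2 * G * (1 / α ^ 2)) := by
            rw [hG]
            ring
        _ ≤ _ := by gcongr
    have t3 : |ratio α c x ^ 2 / 4 * a x| ≤ 1 / 16 * (beta α / c / c * G * (1 / α ^ 5)) := by
      rw [abs_mul, abs_div, abs_pow, abs_of_pos (by norm_num : (0 : ℝ) < 4)]
      calc |ratio α c x| ^ 2 / 4 * |a x| ≤ (beta α / c / 2 * (x * weight α x)) ^ 2 / 4 * 1 := by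
            gcongr
            · exact (abs_ratio_eq hc hx0.le).le
            · exact (abs_le_one_of_sum_sq (hn x)).1
        _ = 1 / 16 * ((beta α / c) ^ 2 * G * 1) := by
            rw [hG]
            ring
        _ ≤ _ := by gcongr
    rw [hkey, hexp]
    have hV : 0 ≤ beta α / c / c * G * (1 / α ^ 5) := by positivity
    calc _ ≤ 9 * (beta α / c / c * G * (1 / α ^ 5)) + 7 / 2 * (beta α / c / c * G * (1 / α ^ 5))
          + 1 / 16 * (beta α / c / c * G * (1 / α ^ 5)) :=
          (abs_add_le _ _).trans (add_le_add ((abs_add_le _ _).trans (add_le_add t1 t2)) t3)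
      _ ≤ 13 * (beta α / c / c * G * (1 / α ^ 5)) := by linarith
      _ = _ := by
          field_simp
  · have hz := (hw.sub_const w).norm
    simp only [sub_self, norm_zero] at hz
    refine squeeze_zero_norm (fun x => ?_) hz
    refine le_trans (le_of_eq ?_) (abs_re_exp_mul_le (c * Phi α x)
      (rotating (fun s => c * Phi α s) a b x - w))
    rw [Real.norm_eq_abs, mul_sub, exp_neg_mul_polar hwφ, rotating, ← mul_assoc, hee]
    simp only [one_mul, Complex.add_re, Complex.sub_re, Complex.mul_re, Complex.ofReal_re,
      Complex.ofReal_im, Complex.I_re, Complex.I_im, mul_zero, zero_mul, add_zero, sub_zero]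

end FrenetSystem

/-! ### Convergence as tempered distributions -/

theorem integrable_schwartz_mul_of_bounded {v : ℝ → ℝ} (hv : Continuous v) {K : ℝ}
    (hK : ∀ x, |v x| ≤ K) (ψ : 𝓢(ℝ, ℂ)) : Integrable (fun x : ℝ => ψ x * (v x : ℂ)) :=
  ψ.integrable.mul_bdd (c := K) (Complex.continuous_ofReal.comp hv).aestronglyMeasurable
    (Eventually.of_forall fun x => by simpa using hK x)

theorem exists_isTemperedDistributionOf {v : ℝ → ℝ} (hv : Continuous v) {K : ℝ}
    (hK : ∀ x, |v x| ≤ K) : ∃ u : 𝓢'(ℝ, ℂ), IsTemperedDistributionOf u v := by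
  have hL : MemLp (fun x => (v x : ℂ)) ⊤ (volume : Measure ℝ) :=
    memLp_top_of_bound (Complex.continuous_ofReal.comp hv).aestronglyMeasurable K
      (Eventually.of_forall fun x => by simpa using hK x)
  refine ⟨Lp.toTemperedDistribution hL.toLp, fun ψ =>
    ⟨integrable_schwartz_mul_of_bounded hv hK ψ, ?_⟩⟩
  rw [Lp.toTemperedDistribution_apply]
  refine integral_congr_ae ?_
  filter_upwards [hL.coeFn_toLp] with x hx
  rw [hx, smul_eq_mul]

theorem norm_integral_schwartz_dilation_le {v F : ℝ → ℝ} (hv : Continuous v) {K K' : ℝ}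
    (hK : ∀ x, |v x| ≤ K) (hF : ∀ x, HasDerivAt F (v x) x) (hF' : ∀ x, |F x| ≤ K')
    (ψ : 𝓢(ℝ, ℂ)) {ε : ℝ} (hε : 0 < ε) :
    ‖∫ x : ℝ, ψ x * (v (x / ε) : ℂ)‖ ≤ ε * K' * ∫ x, ‖deriv ψ x‖ := by
  have hFc : Continuous F := continuous_iff_continuousAt.2 fun x => (hF x).continuousAt
  have hbd : ∀ x, |ε * F (x / ε)| ≤ ε * K' := fun x => by
    rw [abs_mul, abs_of_pos hε]
    exact mul_le_mul_of_nonneg_left (hF' _) hε.le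
  have hc : Continuous fun x => ε * F (x / ε) := by fun_prop
  have hd : ∀ x, HasDerivAt (fun x => ((ε * F (x / ε) : ℝ) : ℂ)) (v (x / ε) : ℂ) x := fun x => by
    refine HasDerivAt.ofReal_comp ?_
    refine (((hF (x / ε)).scomp x ((hasDerivAt_id x).div_const ε)).const_mul ε).congr_deriv ?_
    simp [hε.ne']
  have hi := integral_mul_deriv_eq_deriv_mul_of_integrable (u := ψ) (u' := deriv ψ)
    (v := fun x => ((ε * F (x / ε) : ℝ) : ℂ)) (v' := fun x => (v (x / ε) : ℂ))
    (fun x _ => ψ.hasDerivAt x) (fun x _ => hd x)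
    (integrable_schwartz_mul_of_bounded (by fun_prop) (fun x => hK (x / ε)) ψ)
    (integrable_schwartz_mul_of_bounded hc hbd (SchwartzMap.derivCLM ℝ ℂ ψ))
    (integrable_schwartz_mul_of_bounded hc hbd ψ)
  rw [hi, norm_neg, ← integral_const_mul]
  refine norm_integral_le_of_norm_le
    ((SchwartzMap.derivCLM ℝ ℂ ψ).integrable.norm.const_mul (ε * K'))
    (Eventually.of_forall fun x => ?_)
  rw [norm_mul, Complex.norm_real, mul_comm]
  exact mul_le_mul_of_nonneg_right (hbd x) (norm_nonneg _)

theorem exists_tempered_tendsto_zero {v F : ℝ → ℝ} (hv : Continuous v) {K K' : ℝ}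
    (hK : ∀ x, |v x| ≤ K) (hF : ∀ x, HasDerivAt F (v x) x) (hF' : ∀ x, |F x| ≤ K') (T : ℝ) :
    ∃ u : ℝ → 𝓢'(ℝ, ℂ),
      (∀ t < T, IsTemperedDistributionOf (u t) (fun x => v (x / Real.sqrt (T - t)))) ∧
      Tendsto u (𝓝[<] T) (𝓝 0) := by
  choose u hu using fun t : ℝ => exists_isTemperedDistributionOf
    (v := fun x => v (x / Real.sqrt (T - t))) (by fun_prop) (fun x => hK _)
  refine ⟨u, fun t _ => hu t, ?_⟩
  rw [PointwiseConvergenceCLM.tendsto_iff_forall_tendsto]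
  intro ψ
  have h0 : Tendsto (fun t => Real.sqrt (T - t) * K' * ∫ x, ‖deriv ψ x‖) (𝓝[<] T) (𝓝 0) := by
    have hc : Continuous fun t => Real.sqrt (T - t) * K' * ∫ x, ‖deriv ψ x‖ := by fun_prop
    have := hc.tendsto T
    simp only [sub_self, Real.sqrt_zero, zero_mul] at this
    exact this.mono_left nhdsWithin_le_nhds
  refine squeeze_zero_norm' ?_ h0
  filter_upwards [self_mem_nhdsWithin] with t ht
  rw [(hu t ψ).2]
  exact norm_integral_schwartz_dilation_le hv hK hF hF' ψ (Real.sqrt_pos.2 (sub_pos.2 ht))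

/-! ### The primitive of the profile is bounded -/

namespace FrenetSystem

variable {α c : ℝ} {a b d : ℝ → ℝ}

theorem continuous_a {k τ : ℝ → ℝ} (H : FrenetSystem k τ a b d) : Continuous a :=
  continuous_iff_continuousAt.2 fun x => (H.deriv_a x).continuousAt

theorem hasDerivAt_primitive (H : FrenetSystem (curvature α c) (torsion α) a b d) (x : ℝ) :
    HasDerivAt (fun x => ∫ s in (0 : ℝ)..x, a s) (a x) x :=
  intervalIntegral.integral_hasDerivAt_right (H.continuous_a.intervalIntegrable _ _)
    (H.continuous_a.stronglyMeasurableAtFilter _ _) H.continuous_a.continuousAt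

theorem abs_primitive_le_of_nonneg (H : FrenetSystem (curvature α c) (torsion α) a b d)
    (hn : ∀ x, a x ^ 2 + b x ^ 2 + d x ^ 2 = 1) (h0 : 0 < α) (h1 : α ≤ 1) (hc : 0 < c)
    {x : ℝ} (hx : 0 ≤ x) : |∫ s in (0 : ℝ)..x, a s| ≤ 2 / (α * c) + 2 / c := by
  have hinv : ∀ s, curvature α c s * (weight α s / c) = 1 := fun s => by
    have := weight_mul_exp α s
    rw [curvature]
    field_simp
    linarith
  have hG : ∀ s, HasDerivAt (fun s => (∫ y in (0 : ℝ)..s, a y) + b s * (weight α s / c))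
      (ratio α c s * d s - α * s / 2 * (weight α s / c) * b s) s := fun s => by
    refine ((H.hasDerivAt_primitive s).add
      ((H.deriv_b s).mul ((hasDerivAt_weight α s).div_const c))).congr_deriv ?_
    rw [ratio, torsion]
    linear_combination (-a s) * hinv s
  have hD : ∀ s, HasDerivAt (fun s => 2 / (α * c) - 2 / (α * c) * weight α s)
      (s / c * weight α s) s := fun s => by
    refine (((hasDerivAt_weight α s).const_mul (2 / (α * c))).const_sub _).congr_deriv ?_
    field_simp
  have hle := image_norm_le_of_norm_deriv_right_le_deriv_boundary (a := 0) (b := x)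
    (fun s _ => ((hG s).sub_const (b 0 * (weight α 0 / c))).continuousAt.continuousWithinAt)
    (fun s _ => ((hG s).sub_const (b 0 * (weight α 0 / c))).hasDerivWithinAt)
    (B := fun s => 2 / (α * c) - 2 / (α * c) * weight α s) (by simp [weight]) hD
    (fun s hs => by
      obtain ⟨-, hb1, hd1⟩ := abs_le_one_of_sum_sq (hn s)
      have hw := weight_pos α s
      have hs0 := hs.1
      have hβ := beta_le_one α
      have hβ0 := beta_nonneg α
      rw [Real.norm_eq_abs]
      calc |ratio α c s * d s - α * s / 2 * (weight α s / c) * b s|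
          ≤ |ratio α c s| * |d s| + α * s / 2 * (weight α s / c) * |b s| := by
            refine (abs_sub _ _).trans_eq ?_
            rw [abs_mul, abs_mul _ (b s), abs_of_nonneg (a := _ * _) (by positivity)]
        _ ≤ 1 / c / 2 * (s * weight α s) * 1 + 1 * s / 2 * (weight α s / c) * 1 := by
            rw [abs_ratio_eq hc hs0]
            gcongr
        _ = _ := by ring) (right_mem_Icc.2 hx)
  have hwle : ∀ s, |b s * (weight α s / c)| ≤ 1 / c := fun s => by
    obtain ⟨-, hb1, -⟩ := abs_le_one_of_sum_sq (hn s)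
    have hw := weight_pos α s
    have hw1 : weight α s ≤ 1 := Real.exp_le_one_iff.2 (by nlinarith [sq_nonneg s])
    rw [abs_mul, abs_of_pos (div_pos hw hc)]
    calc _ ≤ 1 * (1 / c) := by gcongr
      _ = _ := one_mul _
  rw [Real.norm_eq_abs] at hle
  have h3 : 0 ≤ 2 / (α * c) * weight α x := mul_nonneg (by positivity) (weight_pos α x).le
  have h4 : 2 / c = 1 / c + 1 / c := by ring
  have := abs_le.1 hle
  have := abs_le.1 (hwle x)
  have := abs_le.1 (hwle 0)
  rw [abs_le]
  constructor <;> linarith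

theorem abs_primitive_le (H : FrenetSystem (curvature α c) (torsion α) a b d)
    (hn : ∀ x, a x ^ 2 + b x ^ 2 + d x ^ 2 = 1) (h0 : 0 < α) (h1 : α ≤ 1) (hc : 0 < c) (x : ℝ) :
    |∫ s in (0 : ℝ)..x, a s| ≤ 2 / (α * c) + 2 / c := by
  rcases le_total 0 x with hx | hx
  · exact H.abs_primitive_le_of_nonneg hn h0 h1 hc hx
  · have h := (H.reflect (curvature_neg α c) (torsion_neg α)).abs_primitive_le_of_nonneg
      (fun x => by simpa using hn (-x)) h0 h1 hc (neg_nonneg.2 hx)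
    rw [intervalIntegral.integral_comp_neg, neg_neg, neg_zero, intervalIntegral.integral_symm,
      abs_neg] at h
    exact h

end FrenetSystem

theorem tendsto_div_sqrt_sub {x : ℝ} (hx : 0 < x) (T : ℝ) :
    Tendsto (fun t => x / Real.sqrt (T - t)) (𝓝[<] T) atTop := by
  have h : Tendsto (fun t => Real.sqrt (T - t)) (𝓝[<] T) (𝓝[>] 0) := by
    refine tendsto_nhdsWithin_iff.2 ⟨?_, ?_⟩
    · have hc : Continuous fun t => Real.sqrt (T - t) := by fun_prop
      have := hc.tendsto T
      simp only [sub_self, Real.sqrt_zero] at this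
      exact this.mono_left nhdsWithin_le_nhds
    · filter_upwards [self_mem_nhdsWithin] with t ht
      exact Real.sqrt_pos.2 (sub_pos.2 ht)
  simp only [div_eq_mul_inv]
  exact h.inv_tendsto_nhdsGT_zero.const_mul_atTop hx

namespace IsShrinkerFrame

variable {α c : ℝ} {f g h : ℝ → E3}

theorem row_sum_sq (H : IsShrinkerFrame α c f g h) (j : Fin 3) (x : ℝ) :
    f x j ^ 2 + g x j ^ 2 + h x j ^ 2 = 1 := by
  simpa [sq] using H.row_inner j j x

theorem asymptotics (H : IsShrinkerFrame α c f g h) (h0 : 0 < α) (h1 : α ≤ 1) (hc : 0 < c) :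
    ∃ ρ B φ : Fin 3 → ℝ,
      (∀ j, ρ j ∈ Icc (0 : ℝ) 1 ∧ B j ∈ Icc (-1 : ℝ) 1 ∧ φ j ∈ Ico 0 (2 * Real.pi)) ∧
      (∀ j, ∀ x : ℝ, 1 ≤ x → |f x j - profileExpansion α c (ρ j) (B j) (φ j) x| ≤
          beta α / (α ^ 5 * c ^ 2) * (13 * (x ^ 2 * Real.exp (-α * x ^ 2 / 2)))) ∧
      (∀ T : ℝ, ∀ j,
        (∀ x : ℝ, 0 < x →
          Tendsto (fun t => shrinker f T x t j
              - ρ j * Real.cos (c * Phi α (x / Real.sqrt (T - t)) - φ j)) (𝓝[<] T) (𝓝 0)) ∧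
        (∀ x : ℝ, x < 0 →
          Tendsto (fun t => shrinker f T x t j
              - paritySign j * ρ j * Real.cos (c * Phi α (-x / Real.sqrt (T - t)) - φ j))
            (𝓝[<] T) (𝓝 0))) := by
  choose ρ B φ hmem hexp hlim using fun j => (H.row j).asymptotics (H.row_sum_sq j) h0 h1 hc
  refine ⟨ρ, B, φ, hmem, hexp, fun T j => ⟨fun x hx => ?_, fun x hx => ?_⟩⟩
  · exact (hlim j).comp (tendsto_div_sqrt_sub hx T)
  · have := ((hlim j).comp (tendsto_div_sqrt_sub (neg_pos.2 hx) T)).const_mul (paritySign j)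
    rw [mul_zero] at this
    refine this.congr fun t => ?_
    have e : shrinker f T x t j = paritySign j * f (-x / Real.sqrt (T - t)) j := by
      rw [← H.even_odd, neg_div, neg_neg, shrinker]
    rw [e, Function.comp_apply]
    ring

theorem exists_tempered_tendsto_zero (H : IsShrinkerFrame α c f g h) (h0 : 0 < α) (h1 : α ≤ 1)
    (hc : 0 < c) (T : ℝ) (j : Fin 3) : ∃ u : ℝ → 𝓢'(ℝ, ℂ),
      (∀ t < T, IsTemperedDistributionOf (u t) (fun x => shrinker f T x t j)) ∧
      Tendsto u (𝓝[<] T) (𝓝 0) :=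
  LLG.exists_tempered_tendsto_zero (H.row j).continuous_a
    (fun x => (FrenetSystem.abs_le_one_of_sum_sq (H.row_sum_sq j x)).1)
    (H.row j).hasDerivAt_primitive
    ((H.row j).abs_primitive_le (H.row_sum_sq j) h0 h1 hc) T

end IsShrinkerFrame

end LLG

theorem theorem5p13 :
    ∃ C : ℝ, 0 < C ∧ ∀ α c : ℝ, 0 < α → α ≤ 1 → 0 < c →
      -- the frame, hence the profile, exists and is unique
      (∃! F : (ℝ → LLG.E3) × (ℝ → LLG.E3) × (ℝ → LLG.E3),
        LLG.IsShrinkerFrame α c F.1 F.2.1 F.2.2) ∧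
      ∀ f g h : ℝ → LLG.E3, LLG.IsShrinkerFrame α c f g h →
        -- smooth solution with values in the sphere, and size of its derivative
        (∀ T : ℝ,
          ContDiffOn ℝ ∞ (fun p : ℝ × ℝ => LLG.shrinker f T p.1 p.2)
            ((univ : Set ℝ) ×ˢ Iio T) ∧
          (∀ x t : ℝ, t < T → LLG.shrinker f T x t ∈ Metric.sphere (0 : LLG.E3) 1) ∧
          LLG.SolvesLLG α T (LLG.shrinker f T) ∧
          (∀ x t : ℝ, t < T →
            ‖deriv (fun y => LLG.shrinker f T y t) x‖ =
              c / Real.sqrt (T - t) * Real.exp (α * x ^ 2 / (4 * (T - t))))) ∧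
        -- parity
        (Function.Even (fun x => f x 0) ∧ Function.Odd (fun x => f x 1) ∧
          Function.Odd (fun x => f x 2)) ∧
        -- asymptotics of the profile and pointwise limits, with the same constants
        (∃ ρ B φ : Fin 3 → ℝ,
          (∀ j, ρ j ∈ Icc (0 : ℝ) 1 ∧ B j ∈ Icc (-1 : ℝ) 1 ∧ φ j ∈ Ico 0 (2 * Real.pi)) ∧
          (∀ j, ∀ x : ℝ, 1 ≤ x →
            |f x j - LLG.profileExpansion α c (ρ j) (B j) (φ j) x| ≤
              LLG.beta α / (α ^ 5 * c ^ 2) * (C * (x ^ 2 * Real.exp (-α * x ^ 2 / 2)))) ∧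
          (∀ T : ℝ, ∀ j,
            (∀ x : ℝ, 0 < x →
              Tendsto (fun t => LLG.shrinker f T x t j
                  - ρ j * Real.cos (c * LLG.Phi α (x / Real.sqrt (T - t)) - φ j))
                (𝓝[<] T) (𝓝 0)) ∧
            (∀ x : ℝ, x < 0 →
              Tendsto (fun t => LLG.shrinker f T x t j
                  - LLG.paritySign j * ρ j
                    * Real.cos (c * LLG.Phi α (-x / Real.sqrt (T - t)) - φ j))
                (𝓝[<] T) (𝓝 0)))) ∧
        -- convergence to zero in the space of tempered distributions
        (∀ T : ℝ, ∀ j, ∃ u : ℝ → 𝓢'(ℝ, ℂ),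
          (∀ t < T, LLG.IsTemperedDistributionOf (u t) (fun x => LLG.shrinker f T x t j)) ∧
          Tendsto u (𝓝[<] T) (𝓝 0)) := by
  refine ⟨13, by norm_num, fun α c h0 h1 hc => ⟨LLG.IsShrinkerFrame.existsUnique α c,
    fun f g h H => ⟨fun T => ⟨H.contDiffOn_shrinker T, fun x t _ => ?_, H.solvesLLG h0 h1 T,
      fun x t ht => H.norm_deriv_shrinker hc ht x⟩,
      ⟨fun x => ?_, fun x => ?_, fun x => ?_⟩, H.asymptotics h0 h1 hc,
      H.exists_tempered_tendsto_zero h0 h1 hc⟩⟩⟩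
  · rw [mem_sphere_zero_iff_norm]
    exact (H.norm_f_g _).1
  · simpa [LLG.paritySign] using H.even_odd 0 x
  · simpa [LLG.paritySign] using H.even_odd 1 x
  · simpa [LLG.paritySign] using H.even_odd 2 x
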